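/- Let $L,M>0$ and let $f:[0,L]\to[0,M]$ be continuous, convex and strictly decreasing with $f(0)=M$ and $f(L)=0$. Let $\Gamma$ be the graph of $f$, let $g:[0,M]\to[0,L]$ be the inverse function of $f$, and let $\operatorname{Area}(\Gamma)$ be the area of the region enclosed by $\Gamma$ and the coordinate axes. For $r,s>0$ let $r\Gamma(s)$ be the graph of $x\mapsto rs\,f(sx/r)$, $0\le x\le rs^{-1}L$, and let $N(r,s)$ be the number of pairs $(j,k)$ of positive integers lying inside or on $r\Gamma(s)$, that is, with $j\le rs^{-1}L$ and $k\le rs\,f(sj/r)$. Put $N=N(1,1)$. Let $(\alpha,\beta)\in\Gamma$ with $\alpha,\beta>0$. Assume $f\in C^2[\alpha,L)$ with $f'<0$ and $f''>0$ on $[\alpha,L)$, and $g\in C^2[\beta,M)$ with $g'<0$ and $g''>0$ on $[\beta,M)$, derivatives at $\alpha$ and $\beta$ being one-sided (from the right). Assume there are partitions $\alpha=\alpha_0<\alpha_1<\dots<\alpha_m=L$ and $\beta=\beta_0<\beta_1<\dots<\beta_n=M$ such that $f''$ is monotonic on each $(\alpha_i,\alpha_{i+1})$ and $g''$ is monotonic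 on each $(\beta_i,\beta_{i+1})$. Then the integrals $\int_\alpha^L f''(x)^{1/3}\,dx$ and $\int_\beta^M g''(y)^{1/3}\,dy$ are finite, and the following hold. (a) Suppose $\Gamma$ (including its endpoints $(0,M)$ and $(L,0)$) passes through no point of $\mathbb Z^2$, that $\alpha<\lfloor L\rfloor$ and $\beta<\lfloor M\rfloor$, and let $0<\delta<\lfloor L\rfloor-\alpha$ and $0<\epsilon<\lfloor M\rfloor-\beta$. Then \begin{align*} \Big|N-\operatorname{Area}(\Gamma)+\frac{L+M}{2}\Big| &\le 6\Big(\int_\alpha^L f''(x)^{1/3}\,dx+\int_\beta^M g''(y)^{1/3}\,dy\Big) +175\Big(\frac1{f''(L-\delta)^{1/2}}+\frac1{g''(M-\epsilon)^{1/2}}\Big)\\ &\quad+525\Big(\sum_{i=0}^{m-1}\frac1{f''(\alpha_i)^{1/2}}+\sum_{i=0}^{n-1}\frac1{g''(\beta_i)^{1/2}}\Big) +\frac14\Big(\sum_{i=0}^{m-1}|f'(\alpha_i)|+\sum_{i=0}^{n-1}|g'(\beta_i)|\Big)\\ &\quad+\frac12(\delta+\epsilon)+3(m+n)+5+\frac LM+\frac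 ML . \end{align*} (b) Suppose $\alpha<L/2$ and $\beta<M/2$, and let $\delta:(0,\infty)\to(0,L/2-\alpha)$ and $\epsilon:(0,\infty)\to(0,M/2-\beta)$ be functions. Then for all $r,s>0$ with $rs^{-1}L\ge1$ and $rsM\ge1$, \begin{align*} \Big|N(r,s)-r^2\operatorname{Area}(\Gamma)+\frac{r(s^{-1}L+sM)}{2}\Big| &\le 6r^{2/3}\Big(\int_\alpha^L f''(x)^{1/3}\,dx+\int_\beta^M g''(y)^{1/3}\,dy\Big)\\ &\quad+175r^{1/2}\Big(\frac{s^{-3/2}}{f''(L-\delta(r))^{1/2}}+\frac{s^{3/2}}{g''(M-\epsilon(r))^{1/2}}\Big)\\ &\quad+525r^{1/2}\Big(\sum_{i=0}^{m-1}\frac{s^{-3/2}}{f''(\alpha_i)^{1/2}}+\sum_{i=0}^{n-1}\frac{s^{3/2}}{g''(\beta_i)^{1/2}}\Big)\\ &\quad+\frac14\Big(\sum_{i=0}^{m-1}s^2|f'(\alpha_i)|+\sum_{i=0}^{n-1}s^{-2}|g'(\beta_i)|\Big)\\ &\quad+\frac12r\big(s^{-1}\delta(r)+s\,\epsilon(r)\big)+3(m+n)+5+s^{-2}\frac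 LM+s^2\frac ML . \end{align*} -/

import Mathlib

open Set MeasureTheory

noncomputable section

/-- A convex, strictly decreasing curve in the first quadrant joining the intercepts `(0, M)` and
`(L, 0)`, presented as the graph of `y = f x` for `x ∈ [0, L]`.  Only the values of `f` on
`[0, L]` are meaningful. -/
structure ConvexCurve where
  /-- the intercept with the `x`-axis -/
  L : ℝ
  /-- the intercept with the `y`-axis -/
  M : ℝ
  /-- the function whose graph over `[0, L]` is the curve -/
  f : ℝ → ℝ
  L_pos : 0 < L
  M_pos : 0 < M
  f_zero : f 0 = M
  f_L : f L = 0
  continuousOn_f : ContinuousOn f (Icc 0 L)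
  strictAntiOn_f : StrictAntiOn f (Icc 0 L)
  convexOn_f : ConvexOn ℝ (Icc 0 L) f

/-- The number of pairs `(j, k)` of positive integers with `j ≤ L` and `k ≤ f j`, that is, of
positive-integer lattice points lying inside or on the graph of `f` over `[0, L]`. -/
def latticeCount (f : ℝ → ℝ) (L : ℝ) : ℕ :=
  Set.ncard {p : ℕ × ℕ | 0 < p.1 ∧ 0 < p.2 ∧ (p.1 : ℝ) ≤ L ∧ (p.2 : ℝ) ≤ f p.1}

namespace ConvexCurve

/-- The inverse function of `f : [0, L] → [0, M]`; only its values on `[0, M]` are meaningful. -/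
def g (Γ : ConvexCurve) : ℝ → ℝ := Function.invFunOn Γ.f (Icc 0 Γ.L)

/-- The curve as a subset of the plane, intercepts included. -/
def graph (Γ : ConvexCurve) : Set (ℝ × ℝ) := {p | p.1 ∈ Icc 0 Γ.L ∧ p.2 = Γ.f p.1}

/-- The area enclosed by the curve and the coordinate axes. -/
def area (Γ : ConvexCurve) : ℝ :=
  volume.real {p : ℝ × ℝ | p.1 ∈ Ioo 0 Γ.L ∧ p.2 ∈ Ioo 0 (Γ.f p.1)}

/-- The counting function `N(r, s)`: the number of positive-integer lattice points lying inside or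
on the scaled curve `r Γ(s)`, the graph of `x ↦ r s f(s x / r)` over `[0, r s⁻¹ L]`. -/
def count (Γ : ConvexCurve) (r s : ℝ) : ℕ :=
  latticeCount (fun x => r * s * Γ.f (s * x / r)) (r * s⁻¹ * Γ.L)

end ConvexCurve

/-- First derivative of `h` on `[a, b)`, one-sided at `a`. -/
def derivIco (h : ℝ → ℝ) (a b : ℝ) : ℝ → ℝ := derivWithin h (Ico a b)

/-- Second derivative of `h` on `[a, b)`, one-sided at `a`. -/
def deriv2Ico (h : ℝ → ℝ) (a b : ℝ) : ℝ → ℝ := derivWithin (derivIco h a b) (Ico a b)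

/-- `h` is of class `C²` on `[a, b)` with `h' < 0` and `h'' > 0` there, and
`a = t 0 < t 1 < ... < t m = b` is a partition such that `h''` is monotonic over each
open subinterval `(t i, t (i + 1))`. -/
structure IsPiecewiseMonotoneC2 (h : ℝ → ℝ) (a b : ℝ) (m : ℕ) (t : ℕ → ℝ) : Prop where
  contDiffOn : ContDiffOn ℝ 2 h (Ico a b)
  deriv_neg : ∀ x ∈ Ico a b, derivIco h a b x < 0
  deriv2_pos : ∀ x ∈ Ico a b, 0 < deriv2Ico h a b x
  first : t 0 = a
  last : t m = b
  lt_succ : ∀ i < m, t i < t (i + 1)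
  monotonic : ∀ i < m,
    MonotoneOn (deriv2Ico h a b) (Ioo (t i) (t (i + 1))) ∨
    AntitoneOn (deriv2Ico h a b) (Ioo (t i) (t (i + 1)))

end

/-! The curve is cut at `(α, β)`. The lattice points under it are those of a rectangle, those in
columns beyond `α` and those in rows beyond `β`, so the count is `⌊α⌋⌊β⌋` plus two sums of floors,
one of `f` and one of `g`. With `ψ x = x - ⌊x⌋ - 1/2` (`sawtooth`), a floor sum is a smooth sum,
minus half the number of terms, minus a sum of `ψ`. Euler–Maclaurin turns the smooth sum into an
area, with error at most a quarter of the initial slope, and the boundary terms at `(α, β)` cancel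
against the expansion of `⌊α⌋⌊β⌋`. It remains to bound `∑ ψ(h n)` along a convex arc `h`.

This is van der Corput's method. Since `ψ` rises with slope 1 and only jumps downwards, it is
bounded above and below, up to `Δ/2`, by its averages over windows of length `Δ`. These averages are
difference quotients of the second Bernoulli function, whose Fourier series converges absolutely.
Each frequency yields an exponential sum, handled by the second derivative test, itself a
consequence of `kusmin_landau`. For second differences of size `λ`, taking `Δ` of order `λ^(1/3)`
gives `O(N λ^(1/3) + λ^(-1/2))`.

Where `h''` is monotonic, the range is cut into blocks on which it at most doubles. The first terms
add up to `6 ∫ h''^(1/3)`, and the second form a geometric series controlled by the least value of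
`h''`. Near the intercept `h''` may tend to 0, so a final stretch of length `δ` is estimated
trivially. For (b) the same estimate is applied to the stretched curve, since each term scales by an
explicit factor. -/

/-! ### The Kusmin–Landau inequality. -/

/-- The additive character `x ↦ exp (2π i x)` of `ℝ`. -/
noncomputable def expi (x : ℝ) : ℂ := Complex.exp ((2 * Real.pi * x : ℝ) * Complex.I)

lemma norm_expi (x : ℝ) : ‖expi x‖ = 1 := Complex.norm_exp_ofReal_mul_I _

lemma expi_add (x y : ℝ) : expi (x + y) = expi x * expi y := by
  unfold expi
  rw [← Complex.exp_add]
  congr 1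
  push_cast
  ring

lemma expi_sub_int (x : ℝ) (v : ℤ) : expi (x - v) = expi x := by
  unfold expi
  rw [Complex.exp_eq_exp_iff_exists_int]
  refine ⟨-v, ?_⟩
  push_cast
  ring

lemma expi_re (x : ℝ) : (expi x).re = Real.cos (2 * Real.pi * x) := by
  unfold expi
  rw [Complex.exp_ofReal_mul_I_re]

lemma expi_eq (x : ℝ) :
    expi x = (Real.cos (2 * Real.pi * x) : ℂ) + (Real.sin (2 * Real.pi * x) : ℂ) * Complex.I := by
  unfold expi
  rw [Complex.exp_mul_I, Complex.ofReal_cos, Complex.ofReal_sin]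

lemma norm_sum_expi_le (x : ℕ → ℝ) (N : ℕ) : ‖∑ n ∈ Finset.range N, expi (x n)‖ ≤ N := by
  refine (norm_sum_le _ _).trans ?_
  simp [norm_expi]

/-- The cotangent of `π d`. -/
noncomputable def cotPi (d : ℝ) : ℝ := Real.cos (Real.pi * d) / Real.sin (Real.pi * d)

lemma two_mul_le_sin_pi {θ d : ℝ} (hθ : 0 < θ) (h1 : θ ≤ d) (h2 : d ≤ 1 - θ) :
    2 * θ ≤ Real.sin (Real.pi * d) := by
  have hpi := Real.pi_pos
  rcases le_total d (1 / 2) with h | h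
  · have := Real.mul_le_sin (x := Real.pi * d) (mul_nonneg hpi.le (by linarith)) (by nlinarith)
    have e : 2 / Real.pi * (Real.pi * d) = 2 * d := by field_simp
    linarith
  · have := Real.mul_le_sin (x := Real.pi * (1 - d)) (by nlinarith) (by nlinarith)
    have e : 2 / Real.pi * (Real.pi * (1 - d)) = 2 * (1 - d) := by field_simp
    have e2 : Real.sin (Real.pi * (1 - d)) = Real.sin (Real.pi * d) := by
      rw [mul_sub, mul_one, Real.sin_pi_sub]
    linarith

lemma abs_cotPi_le {θ d : ℝ} (hθ : 0 < θ) (h1 : θ ≤ d) (h2 : d ≤ 1 - θ) :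
    |cotPi d| ≤ 1 / (2 * θ) := by
  have hs := two_mul_le_sin_pi hθ h1 h2
  unfold cotPi
  rw [abs_div, abs_of_pos (by linarith : 0 < Real.sin (Real.pi * d))]
  exact div_le_div₀ zero_le_one (Real.abs_cos_le_one _) (mul_pos two_pos hθ) hs

lemma cotPi_anti {θ c d : ℝ} (hθ : 0 < θ) (h1 : θ ≤ c) (h2 : c ≤ d) (h3 : d ≤ 1 - θ) :
    cotPi d ≤ cotPi c := by
  have hc := two_mul_le_sin_pi hθ h1 (h2.trans h3)
  have hd := two_mul_le_sin_pi hθ (h1.trans h2) h3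
  have hpi := Real.pi_pos
  unfold cotPi
  rw [div_le_div_iff₀ (by linarith) (by linarith), ← sub_nonneg]
  have : Real.sin (Real.pi * d - Real.pi * c) =
      Real.cos (Real.pi * c) * Real.sin (Real.pi * d) -
        Real.cos (Real.pi * d) * Real.sin (Real.pi * c) := by
    rw [Real.sin_sub]; ring
  rw [← this]
  apply Real.sin_nonneg_of_nonneg_of_le_pi <;> nlinarith

/-- The inverse of `1 - expi d`. -/
noncomputable def klCoeff (d : ℝ) : ℂ := (1 + cotPi d * Complex.I) / 2

lemma klCoeff_mul {d : ℝ} (hd : Real.sin (Real.pi * d) ≠ 0) : klCoeff d * (1 - expi d) = 1 := by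
  have h2 : 2 * Real.pi * d = 2 * (Real.pi * d) := by ring
  rw [expi_eq, h2, Real.cos_two_mul, Real.sin_two_mul]
  unfold klCoeff cotPi
  have hs : (Real.sin (Real.pi * d) : ℂ) ≠ 0 := by exact_mod_cast hd
  have h1 : (Real.sin (Real.pi * d) : ℂ) ^ 2 + (Real.cos (Real.pi * d) : ℂ) ^ 2 = 1 := by
    exact_mod_cast Real.sin_sq_add_cos_sq (Real.pi * d)
  push_cast at *
  generalize Complex.sin (Real.pi * d) = s at *
  generalize Complex.cos (Real.pi * d) = c at *
  have hI := Complex.I_sq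
  field_simp
  linear_combination -2 * c ^ 2 * s * hI - 2 * Complex.I * c * h1

/-- Since `1 + cot² = 1 / sin²`, the norm is exactly `1 / (2 sin (π d))`. -/
lemma norm_klCoeff_le {θ d : ℝ} (hθ : 0 < θ) (h1 : θ ≤ d) (h2 : d ≤ 1 - θ) :
    ‖klCoeff d‖ ≤ 1 / (4 * θ) := by
  have hs := two_mul_le_sin_pi hθ h1 h2
  have hn : ‖1 + (cotPi d : ℂ) * Complex.I‖ = 1 / Real.sin (Real.pi * d) := by
    have h := Complex.norm_add_mul_I 1 (cotPi d)
    push_cast at h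
    rw [h, Real.sqrt_eq_iff_mul_self_eq (by positivity) (by
      apply div_nonneg zero_le_one; linarith)]
    unfold cotPi
    have := Real.sin_sq_add_cos_sq (Real.pi * d)
    have h0 : Real.sin (Real.pi * d) ≠ 0 := by linarith
    field_simp
    linarith
  unfold klCoeff
  rw [norm_div, hn]
  simp only [Complex.norm_ofNat]
  rw [div_div]
  apply one_div_le_one_div_of_le <;> linarith

/-- The Kusmin–Landau inequality. -/
lemma kusmin_landau (x : ℕ → ℝ) (N : ℕ) (v : ℤ) {θ : ℝ} (hθ : 0 < θ)
    (hmono : ∀ n, n + 1 < N → x (n + 1) - x n ≤ x (n + 2) - x (n + 1))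
    (hlow : ∀ n < N, v + θ ≤ x (n + 1) - x n) (hup : ∀ n < N, x (n + 1) - x n ≤ v + 1 - θ) :
    ‖∑ n ∈ Finset.range N, expi (x n)‖ ≤ 1 / θ := by
  set d : ℕ → ℝ := fun n => x (n + 1) - x n - v with hd
  have hz : ∀ n < N, klCoeff (d n) * (expi (x n) - expi (x (n + 1))) = expi (x n) := by
    intro n hn
    have h1 : θ ≤ d n := by have := hlow n hn; simp only [hd]; linarith
    have h2 : d n ≤ 1 - θ := by have := hup n hn; simp only [hd]; linarith
    have hs := two_mul_le_sin_pi hθ h1 h2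
    have e1 : expi (x (n + 1)) = expi (x n) * expi (d n) := by
      simp only [hd]
      rw [expi_sub_int, ← expi_add]
      congr 1; ring
    rw [e1, ← mul_one_sub, mul_left_comm, klCoeff_mul (by linarith), mul_one]
  -- Summation by parts of `hz`. Consecutive coefficients differ by an imaginary number of constant
  -- sign, because the cotangent decreases, so the variations add up to one difference of
  -- cotangents.
  have key : ∀ k, k < N → ‖∑ n ∈ Finset.range (k + 1), expi (x n) - klCoeff (d 0) * expi (x 0)
      + klCoeff (d k) * expi (x (k + 1))‖ ≤ (cotPi (d 0) - cotPi (d k)) / 2 := by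
    intro k
    induction k with
    | zero =>
      intro hk
      have := hz 0 hk
      simp only [zero_add, Finset.range_one, Finset.sum_singleton, sub_self, zero_div,
        norm_le_zero_iff]
      simp only [zero_add] at this
      linear_combination -this
    | succ k ih =>
      intro hk
      have ih := ih (by omega)
      have e := hz (k + 1) hk
      rw [Finset.sum_range_succ]
      have e2 : ∑ n ∈ Finset.range (k + 1), expi (x n) + expi (x (k + 1))
          - klCoeff (d 0) * expi (x 0) + klCoeff (d (k + 1)) * expi (x (k + 1 + 1)) =
          (∑ n ∈ Finset.range (k + 1), expi (x n) - klCoeff (d 0) * expi (x 0)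
            + klCoeff (d k) * expi (x (k + 1))) +
          (klCoeff (d (k + 1)) - klCoeff (d k)) * expi (x (k + 1)) := by
        linear_combination -e
      rw [e2]
      refine (norm_add_le _ _).trans ?_
      rw [norm_mul, norm_expi, mul_one]
      have e3 : klCoeff (d (k + 1)) - klCoeff (d k) =
          ((cotPi (d (k + 1)) - cotPi (d k)) / 2 : ℝ) * Complex.I := by
        unfold klCoeff; push_cast; ring
      have hle : cotPi (d (k + 1)) ≤ cotPi (d k) := by
        refine cotPi_anti hθ ?_ ?_ ?_
        · have := hlow k (by omega); simp only [hd]; linarith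
        · have := hmono k (by omega); simp only [hd]; linarith
        · have := hup (k + 1) (by omega); simp only [hd]; linarith
      rw [e3, norm_mul, Complex.norm_I, mul_one, Complex.norm_real, Real.norm_eq_abs,
        abs_of_nonpos (by linarith)]
      linarith
  rcases Nat.eq_zero_or_pos N with rfl | hN
  · simp; positivity
  obtain ⟨k, rfl⟩ : ∃ k, N = k + 1 := ⟨N - 1, by omega⟩
  have hr : ∀ n < k + 1, θ ≤ d n ∧ d n ≤ 1 - θ := by
    intro n hn
    have := hlow n hn
    have := hup n hn
    constructor <;> simp only [hd] <;> linarith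
  have h0 := hr 0 (by omega)
  have hk := hr k (by omega)
  have h := key k (by omega)
  have a0 := abs_le.mp (abs_cotPi_le hθ h0.1 h0.2)
  have ak := abs_le.mp (abs_cotPi_le hθ hk.1 hk.2)
  have n0 := norm_klCoeff_le hθ h0.1 h0.2
  have nk := norm_klCoeff_le hθ hk.1 hk.2
  have e : ∑ n ∈ Finset.range (k + 1), expi (x n) =
      (∑ n ∈ Finset.range (k + 1), expi (x n) - klCoeff (d 0) * expi (x 0)
      + klCoeff (d k) * expi (x (k + 1))) + klCoeff (d 0) * expi (x 0)
      - klCoeff (d k) * expi (x (k + 1)) := by ring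
  rw [e]
  refine (norm_sub_le _ _).trans ?_
  have := norm_add_le (∑ n ∈ Finset.range (k + 1), expi (x n) - klCoeff (d 0) * expi (x 0)
      + klCoeff (d k) * expi (x (k + 1))) (klCoeff (d 0) * expi (x 0))
  rw [norm_mul (klCoeff (d 0)), norm_expi, mul_one] at this
  rw [norm_mul (klCoeff (d k)), norm_expi, mul_one]
  -- The cotangent difference costs half of `1 / θ`, and each of the two boundary terms a quarter.
  have e1 : 1 / (2 * θ) = 1 / θ / 2 := by field_simp
  have e2 : 1 / (4 * θ) = 1 / θ / 4 := by field_simp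
  rw [e1] at a0 ak
  rw [e2] at n0 nk
  linarith [a0.1, a0.2, ak.1, ak.2]

/-! ### The second derivative test. -/

/-- A monotone sequence below a threshold on an initial segment. -/
lemma exists_initial_segment (d : ℕ → ℝ) (N : ℕ) (hmono : ∀ n, n + 1 < N → d n ≤ d (n + 1))
    (c : ℝ) : ∃ k ≤ N, (∀ n < k, d n < c) ∧ ∀ n, k ≤ n → n < N → c ≤ d n := by
  induction N with
  | zero => exact ⟨0, le_rfl, by simp, by simp⟩
  | succ N ih =>
    obtain ⟨k, hk, h1, h2⟩ := ih (fun n hn => hmono n (by omega))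
    rcases Nat.lt_or_ge k N with h | h
    · refine ⟨k, by omega, h1, fun n hn hN => ?_⟩
      rcases Nat.lt_or_ge n N with h' | h'
      · exact h2 n hn h'
      · have e : n = N - 1 + 1 := by omega
        have := h2 (N - 1) (by omega) (by omega)
        have h3 := hmono (N - 1) (by omega)
        rw [e]; linarith
    · have : k = N := by omega
      subst this
      by_cases hc : d k < c
      · refine ⟨k + 1, le_rfl, fun n hn => ?_, fun n hn hN => by omega⟩
        rcases Nat.lt_or_ge n k with h' | h'
        · exact h1 n h'
        · have : n = k := by omega
          rw [this]; exact hc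
      · refine ⟨k, by omega, h1, fun n hn hN => ?_⟩
        have : n = k := by omega
        rw [this]; linarith

/-- First differences within `θ` of `v` number at most `2 * θ / μ + 1`, as they grow by at least `μ`
each time, and are bounded trivially. The later ones keep distance `θ` from the integers, so
Kusmin–Landau applies. -/
lemma norm_sum_expi_window (x : ℕ → ℝ) (N : ℕ) (v : ℤ) {θ μ : ℝ} (hθ : 0 < θ) (hμ : 0 < μ)
    (hstep : ∀ n, n + 1 < N → x (n + 1) - x n + μ ≤ x (n + 2) - x (n + 1))
    (hlow : ∀ n < N, v ≤ x (n + 1) - x n + θ) (hup : ∀ n < N, x (n + 1) - x n + θ < v + 1) :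
    ‖∑ n ∈ Finset.range N, expi (x n)‖ ≤ 2 * θ / μ + 1 + 1 / θ := by
  obtain ⟨k, hk, h1, h2⟩ := exists_initial_segment (fun n => x (n + 1) - x n) N
    (fun n hn => by have := hstep n hn; linarith) (v + θ)
  obtain ⟨l, rfl⟩ := Nat.exists_eq_add_of_le hk
  rw [Finset.sum_range_add]
  refine (norm_add_le _ _).trans ?_
  have hA : ‖∑ n ∈ Finset.range k, expi (x n)‖ ≤ 2 * θ / μ + 1 := by
    refine (norm_sum_expi_le x k).trans ?_
    rcases Nat.eq_zero_or_pos k with rfl | hk0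
    · simp; positivity
    have hlin : ∀ n < k, x 1 - x 0 + n * μ ≤ x (n + 1) - x n := by
      intro n
      induction n with
      | zero => simp
      | succ n ih =>
        intro hn
        have := ih (by omega)
        have := hstep n (by omega)
        push_cast
        linarith
    have a := hlin (k - 1) (by omega)
    have b := h1 (k - 1) (by omega)
    have c := hlow 0 (by omega)
    have e : ((k - 1 : ℕ) : ℝ) = k - 1 := by push_cast [hk0]; ring
    rw [e] at a
    have : ((k : ℝ) - 1) * μ ≤ 2 * θ := by simp only [zero_add] at c; linarith
    rw [← sub_le_iff_le_add, le_div_iff₀ hμ]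
    exact this
  have hB : ‖∑ n ∈ Finset.range l, expi (x (k + n))‖ ≤ 1 / θ := by
    refine kusmin_landau (fun n => x (k + n)) l v hθ ?_ ?_ ?_
    · intro n hn
      have := hstep (k + n) (by omega)
      simp only [add_assoc] at this ⊢
      linarith
    · intro n hn
      exact h2 (k + n) (by omega) (by omega)
    · intro n hn
      have := hup (k + n) (by omega)
      simp only [add_assoc] at this ⊢
      linarith
  linarith

/-- The range of the first differences is cut into `j` windows of unit length, each holding a
contiguous block of indices. -/
lemma norm_sum_expi_windows (j : ℕ) {θ μ : ℝ} (hθ : 0 < θ) (hμ : 0 < μ) :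
    ∀ (x : ℕ → ℝ) (N : ℕ) (v : ℤ),
    (∀ n, n + 1 < N → x (n + 1) - x n + μ ≤ x (n + 2) - x (n + 1)) →
    (∀ n < N, v ≤ x (n + 1) - x n + θ) → (∀ n < N, x (n + 1) - x n + θ < v + j) →
    ‖∑ n ∈ Finset.range N, expi (x n)‖ ≤ j * (2 * θ / μ + 1 + 1 / θ) := by
  induction j with
  | zero =>
    intro x N v _ hlow hup
    rcases Nat.eq_zero_or_pos N with rfl | hN
    · simp
    · have := hlow 0 hN
      have := hup 0 hN
      simp only [Nat.cast_zero, add_zero] at this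
      linarith
  | succ j ih =>
    intro x N v hstep hlow hup
    obtain ⟨k, hk, h1, h2⟩ := exists_initial_segment (fun n => x (n + 1) - x n) N
      (fun n hn => by have := hstep n hn; linarith) (v + 1 - θ)
    obtain ⟨l, rfl⟩ := Nat.exists_eq_add_of_le hk
    rw [Finset.sum_range_add]
    refine (norm_add_le _ _).trans ?_
    have hA := norm_sum_expi_window x k v hθ hμ (fun n hn => hstep n (by omega))
      (fun n hn => hlow n (by omega)) (fun n hn => by have := h1 n hn; linarith)
    have hB := ih (fun n => x (k + n)) l (v + 1)
      (fun n hn => by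
        have := hstep (k + n) (by omega)
        simp only [add_assoc] at this ⊢
        linarith)
      (fun n hn => by
        have := h2 (k + n) (by omega) (by omega)
        simp only [add_assoc] at this ⊢
        push_cast
        linarith)
      (fun n hn => by
        have := hup (k + n) (by omega)
        simp only [add_assoc] at this ⊢
        push_cast at this ⊢
        linarith)
    push_cast
    linarith

/-- The second derivative test of van der Corput, for sequences. -/
lemma norm_sum_expi_le_of_second_diff (x : ℕ → ℝ) (N : ℕ) {μ : ℝ} (hμ : 0 < μ)
    (hlow : ∀ n, n + 2 < N → μ ≤ x (n + 2) - 2 * x (n + 1) + x n)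
    (hup : ∀ n, n + 2 < N → x (n + 2) - 2 * x (n + 1) + x n ≤ 2 * μ) :
    ‖∑ n ∈ Finset.range N, expi (x n)‖ ≤ 6 * √μ * N + 7 / √μ := by
  have hs : 0 < √μ := Real.sqrt_pos.mpr hμ
  have hsq : √μ * √μ = μ := Real.mul_self_sqrt hμ.le
  rcases le_total (1 / 6) (√μ) with h | h
  · refine (norm_sum_expi_le x N).trans ?_
    have : (0 : ℝ) ≤ N := N.cast_nonneg
    have h7 : 0 < 7 / √μ := by positivity
    nlinarith
  have hone : 1 ≤ 1 / √μ / 6 := by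
    rw [div_div, le_div_iff₀ (by positivity)]; linarith
  rcases Nat.lt_or_ge N 2 with hN | hN
  · refine (norm_sum_expi_le x N).trans ?_
    have h1 : (N : ℝ) ≤ 1 := by exact_mod_cast (by omega : N ≤ 1)
    have h7 : 7 / √μ = 7 * (1 / √μ) := by ring
    have : 0 ≤ 6 * √μ * N := by positivity
    rw [h7]
    linarith
  obtain ⟨K, rfl⟩ : ∃ K, N = K + 2 := ⟨N - 2, by omega⟩
  -- Close to the minimiser of `2 * θ / μ + 1 / θ`. One window then costs `(3/2 + 4/3 + 1/6) / √μ =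
  -- 3 / √μ`, the `1/6` absorbing the summand 1.
  set θ : ℝ := 3 / 4 * √μ with hθd
  have hθ : 0 < θ := by positivity
  have hlin : ∀ n < K + 1, x (n + 1) - x n ≤ x 1 - x 0 + n * (2 * μ) := by
    intro n
    induction n with
    | zero => simp
    | succ n ih =>
      intro hn
      have := ih (by omega)
      have := hup n (by omega)
      push_cast
      linarith
  have hlin' : ∀ n < K + 1, x 1 - x 0 ≤ x (n + 1) - x n := by
    intro n
    induction n with
    | zero => simp
    | succ n ih =>
      intro hn
      have := ih (by omega)
      have := hlow n (by omega)
      linarith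
  set v : ℤ := ⌊x 1 - x 0 + θ⌋ with hv
  -- The first difference lies in the window at `v`, and the others exceed it by at most `2 * μ *
  -- K`; hence this many windows.
  obtain ⟨j, hj⟩ : ∃ j : ℕ, j = ⌊2 * μ * K⌋₊ + 2 := ⟨_, rfl⟩
  have hj1 : (j : ℝ) ≤ 2 * μ * K + 2 := by
    rw [hj]; push_cast
    linarith [Nat.floor_le (by positivity : (0 : ℝ) ≤ 2 * μ * K)]
  have hj2 : 2 * μ * K + 1 < (j : ℝ) := by
    rw [hj]; push_cast
    linarith [Nat.lt_floor_add_one (2 * μ * K)]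
  have hv1 : (v : ℝ) ≤ x 1 - x 0 + θ := Int.floor_le _
  have hv2 : x 1 - x 0 + θ < v + 1 := Int.lt_floor_add_one _
  have hmain := norm_sum_expi_windows j hθ hμ x (K + 1) v
    (fun n hn => by have := hlow n (by omega); linarith)
    (fun n hn => by have := hlin' n hn; linarith)
    (fun n hn => by
      have := hlin n hn
      have h1 : (n : ℝ) ≤ K := by exact_mod_cast (by omega : n ≤ K)
      have h2 : (n : ℝ) * (2 * μ) ≤ K * (2 * μ) := by gcongr
      linarith)
  have hW : 2 * θ / μ + 1 + 1 / θ ≤ 3 * (1 / √μ) := by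
    have e1 : 2 * θ / μ = 3 / 2 * (1 / √μ) := by
      rw [hθd, div_eq_iff hμ.ne']
      nth_rewrite 3 [← hsq]
      field_simp
      norm_num
    have e2 : 1 / θ = 4 / 3 * (1 / √μ) := by
      rw [hθd]; field_simp
    rw [e1, e2]; linarith
  -- The last term is split off: its forward difference would involve `x N`, about which nothing is
  -- assumed.
  rw [Finset.sum_range_succ]
  refine (norm_add_le _ _).trans ?_
  rw [norm_expi]
  have h1 : (j : ℝ) * (2 * θ / μ + 1 + 1 / θ) ≤ (2 * μ * K + 2) * (3 * (1 / √μ)) := by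
    gcongr
  have e3 : μ * (1 / √μ) = √μ := by
    nth_rewrite 1 [← hsq]
    field_simp
  have e4 : (2 * μ * K + 2) * (3 * (1 / √μ)) = 6 * √μ * K + 6 * (1 / √μ) := by
    linear_combination 6 * (K : ℝ) * e3
  have e5 : 7 / √μ = 7 * (1 / √μ) := by ring
  rw [e5]
  push_cast
  nlinarith

/-! ### Smoothing the sawtooth and expanding in Fourier series. -/

/-- The sawtooth function `x - ⌊x⌋ - 1/2`. -/
noncomputable def sawtooth (x : ℝ) : ℝ := Int.fract x - 1 / 2

/-- The periodic second Bernoulli function. -/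
noncomputable def bernTwo (x : ℝ) : ℝ := Int.fract x ^ 2 - Int.fract x + 1 / 6

lemma abs_sawtooth_le (x : ℝ) : |sawtooth x| ≤ 1 / 2 := by
  have h1 := Int.fract_nonneg x
  have h2 := (Int.fract_lt_one x).le
  unfold sawtooth
  rw [abs_le]
  constructor <;> linarith

lemma abs_sum_sawtooth_le {ι : Type*} (s : Finset ι) (x : ι → ℝ) :
    |∑ i ∈ s, sawtooth (x i)| ≤ s.card / 2 := by
  refine (Finset.abs_sum_le_sum_abs _ _).trans ?_
  refine (Finset.sum_le_sum fun i _ => abs_sawtooth_le (x i)).trans ?_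
  rw [Finset.sum_const, nsmul_eq_mul]
  linarith

lemma floor_eq_sub_sawtooth (x : ℝ) : (⌊x⌋ : ℝ) = x - 1 / 2 - sawtooth x := by
  unfold sawtooth
  rw [← Int.self_sub_fract]
  ring

/-- From `ψ x ≤ ψ (x - t) + t` for `t ≥ 0`, averaged over `t ∈ [0, Δ]`; the mean of `ψ` is a
difference quotient of `bernTwo / 2`. The next lemma averages over the window to the right of `x`.
-/
lemma sawtooth_le {Δ : ℝ} (h0 : 0 < Δ) (h1 : Δ ≤ 1) (x : ℝ) :
    sawtooth x ≤ Δ / 2 + (bernTwo x - bernTwo (x + -Δ)) / (2 * Δ) := by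
  have hu0 := Int.fract_nonneg x
  have hu1 := Int.fract_lt_one x
  unfold sawtooth bernTwo
  have hx := Int.floor_add_fract x
  rw [← sub_le_iff_le_add', le_div_iff₀ (by positivity)]
  rcases le_or_gt Δ (Int.fract x) with h | h
  · have e : Int.fract (x + -Δ) = Int.fract x - Δ := by
      rw [Int.fract_eq_iff]
      exact ⟨by linarith, by linarith, ⌊x⌋, by linarith⟩
    rw [e]
    nlinarith
  · have e : Int.fract (x + -Δ) = Int.fract x - Δ + 1 := by
      rw [Int.fract_eq_iff]
      exact ⟨by linarith, by linarith, ⌊x⌋ - 1, by push_cast; linarith⟩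
    rw [e]
    nlinarith

lemma le_sawtooth {Δ : ℝ} (h0 : 0 < Δ) (h1 : Δ ≤ 1) (x : ℝ) :
    -(Δ / 2) + (bernTwo (x + Δ) - bernTwo x) / (2 * Δ) ≤ sawtooth x := by
  have hu0 := Int.fract_nonneg x
  have hu1 := Int.fract_lt_one x
  unfold sawtooth bernTwo
  have hx := Int.floor_add_fract x
  rw [neg_add_le_iff_le_add, ← sub_le_iff_le_add', sub_le_iff_le_add', div_le_iff₀ (by positivity)]
  rcases lt_or_ge (Int.fract x + Δ) 1 with h | h
  · have e : Int.fract (x + Δ) = Int.fract x + Δ := by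
      rw [Int.fract_eq_iff]
      exact ⟨by linarith, by linarith, ⌊x⌋, by linarith⟩
    rw [e]
    nlinarith
  · have e : Int.fract (x + Δ) = Int.fract x + Δ - 1 := by
      rw [Int.fract_eq_iff]
      exact ⟨by linarith, by linarith, ⌊x⌋ + 1, by push_cast; linarith⟩
    rw [e]
    nlinarith

/-- The classical cosine series; the term `h = 0` vanishes because `1 / 0 = 0`. -/
lemma hasSum_bernTwo (x : ℝ) :
    HasSum (fun h : ℕ => 1 / (h : ℝ) ^ 2 * (expi (h * x)).re) (Real.pi ^ 2 * bernTwo x) := by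
  have h := hasSum_one_div_nat_pow_mul_cos one_ne_zero (x := Int.fract x)
    ⟨Int.fract_nonneg x, (Int.fract_lt_one x).le⟩
  have hb := bernoulliFun_two (Int.fract x)
  unfold bernoulliFun at hb
  simp only [mul_one] at h
  rw [hb] at h
  convert h using 1
  · funext n
    have : (n : ℝ) * Int.fract x = n * x - ((n * ⌊x⌋ : ℤ) : ℝ) := by
      rw [← Int.self_sub_floor]; push_cast; ring
    rw [show 2 * Real.pi * (n : ℝ) * Int.fract x = 2 * Real.pi * (n * Int.fract x) by ring,
      ← expi_re, this, expi_sub_int]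
  · unfold bernTwo
    simp only [Nat.factorial]
    push_cast
    ring

lemma norm_expi_sub_one_le (t : ℝ) : ‖expi t - 1‖ ≤ 2 * Real.pi * |t| := by
  have h := Real.norm_exp_I_mul_ofReal_sub_one_le (x := 2 * Real.pi * t)
  unfold expi
  rw [mul_comm Complex.I] at h
  refine h.trans ?_
  rw [Real.norm_eq_abs, abs_mul, abs_of_pos Real.two_pi_pos]

/-- A shift by `s` multiplies the `h`-th mode by `expi (h * s)`, so the factor `‖expi (h * s) - 1‖`
damps low frequencies. Bounds on partial sums pass to the limit. -/
lemma abs_sum_bernTwo_le (x : ℕ → ℝ) (N : ℕ) (s C : ℝ)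
    (hC : ∀ H : ℕ, ∑ h ∈ Finset.range H, 1 / ((h + 1 : ℕ) : ℝ) ^ 2 *
      (‖expi ((h + 1 : ℕ) * s) - 1‖ * ‖∑ n ∈ Finset.range N, expi ((h + 1 : ℕ) * x n)‖) ≤ C) :
    Real.pi ^ 2 * |∑ n ∈ Finset.range N, (bernTwo (x n + s) - bernTwo (x n))| ≤ C := by
  have h1 : HasSum (fun h : ℕ => ∑ n ∈ Finset.range N,
      (1 / (h : ℝ) ^ 2 * (expi (h * (x n + s))).re - 1 / (h : ℝ) ^ 2 * (expi (h * x n)).re))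
      (∑ n ∈ Finset.range N, (Real.pi ^ 2 * bernTwo (x n + s) - Real.pi ^ 2 * bernTwo (x n))) :=
    hasSum_sum fun n _ => (hasSum_bernTwo _).sub (hasSum_bernTwo _)
  have e1 : ∑ n ∈ Finset.range N, (Real.pi ^ 2 * bernTwo (x n + s) - Real.pi ^ 2 * bernTwo (x n))
      = Real.pi ^ 2 * ∑ n ∈ Finset.range N, (bernTwo (x n + s) - bernTwo (x n)) := by
    rw [Finset.mul_sum]
    exact Finset.sum_congr rfl fun n _ => by ring
  rw [e1] at h1
  have h2 := h1.tendsto_sum_nat.abs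
  rw [abs_mul, abs_of_nonneg (sq_nonneg Real.pi)] at h2
  refine le_of_tendsto h2 (Filter.eventually_atTop.mpr ⟨1, fun H hH => ?_⟩)
  obtain ⟨H, rfl⟩ : ∃ H', H = H' + 1 := ⟨H - 1, by omega⟩
  rw [Finset.sum_range_succ']
  simp only [Nat.cast_zero, ne_eq, OfNat.ofNat_ne_zero, not_false_eq_true, zero_pow, div_zero,
    zero_mul, sub_self, Finset.sum_const_zero, add_zero]
  refine le_trans ?_ (hC H)
  refine (Finset.abs_sum_le_sum_abs _ _).trans (Finset.sum_le_sum fun h _ => ?_)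
  generalize h + 1 = k
  have e2 : ∑ n ∈ Finset.range N,
      (1 / (k : ℝ) ^ 2 * (expi (k * (x n + s))).re - 1 / (k : ℝ) ^ 2 * (expi (k * x n)).re) =
      1 / (k : ℝ) ^ 2 * ((expi (k * s) - 1) * ∑ n ∈ Finset.range N, expi (k * x n)).re := by
    rw [Finset.mul_sum, Complex.re_sum, Finset.mul_sum]
    refine Finset.sum_congr rfl fun n _ => ?_
    rw [← mul_sub, ← Complex.sub_re]
    congr 2
    rw [mul_add, expi_add]
    ring
  rw [e2, abs_mul, abs_of_nonneg (by positivity : 0 ≤ 1 / (k : ℝ) ^ 2), ← norm_mul]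
  gcongr
  exact Complex.abs_re_le_norm _

/-- Here and in the next lemma, integral comparisons for `h ^ (-1/2)` and `h ^ (-3/2)` are put in
telescoping form. -/
lemma one_div_sqrt_succ_le (k : ℕ) : 1 / √((k + 1 : ℕ) : ℝ) ≤ 2 * (√((k + 1 : ℕ) : ℝ) - √(k : ℝ)) := by
  have ha : 0 ≤ √(k : ℝ) := Real.sqrt_nonneg _
  have hb : 0 < √((k + 1 : ℕ) : ℝ) := Real.sqrt_pos.mpr (by positivity)
  have h1 := Real.mul_self_sqrt (Nat.cast_nonneg (α := ℝ) k)
  have h2 := Real.mul_self_sqrt (Nat.cast_nonneg (α := ℝ) (k + 1))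
  push_cast at *
  rw [div_le_iff₀ hb]
  nlinarith [sq_nonneg (√((k : ℝ) + 1) - √(k : ℝ))]

lemma one_div_mul_sqrt_succ_le {k : ℕ} (hk : 0 < k) :
    1 / (((k + 1 : ℕ) : ℝ) * √((k + 1 : ℕ) : ℝ)) ≤ 2 / √(k : ℝ) - 2 / √((k + 1 : ℕ) : ℝ) := by
  have ha : 0 < √(k : ℝ) := Real.sqrt_pos.mpr (by positivity)
  have hb : 0 < √((k + 1 : ℕ) : ℝ) := Real.sqrt_pos.mpr (by positivity)
  have hab : √(k : ℝ) ≤ √((k + 1 : ℕ) : ℝ) := Real.sqrt_le_sqrt (by push_cast; linarith)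
  have h1 := Real.mul_self_sqrt (Nat.cast_nonneg (α := ℝ) k)
  have h2 := Real.mul_self_sqrt (Nat.cast_nonneg (α := ℝ) (k + 1))
  push_cast at *
  generalize √(k : ℝ) = a at *
  generalize √((k : ℝ) + 1) = b at *
  rw [← h2, div_sub_div _ _ ha.ne' hb.ne', div_le_div_iff₀ (by positivity) (by positivity)]
  have h3 : (b - a) * (b + a) = 1 := by linarith
  have h4 : 1 ≤ (b - a) * (2 * b) := by nlinarith
  have h5 : a * b * 1 ≤ a * b * ((b - a) * (2 * b)) := by gcongr
  have h6 : a * b * ((b - a) * (2 * b)) ≤ b * b * ((b - a) * (2 * b)) := by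
    have : 0 ≤ (b - a) * (2 * b) := by linarith
    gcongr
  nlinarith

lemma sum_one_div_mul_sqrt_le (H : ℕ) :
    ∑ h ∈ Finset.range H, 1 / (((h + 1 : ℕ) : ℝ) * √((h + 1 : ℕ) : ℝ)) ≤ 3 := by
  have key : ∀ H : ℕ, ∑ h ∈ Finset.range (H + 1), 1 / (((h + 1 : ℕ) : ℝ) * √((h + 1 : ℕ) : ℝ)) ≤
      3 - 2 / √((H + 1 : ℕ) : ℝ) := by
    intro H
    induction H with
    | zero => norm_num
    | succ H ih =>
      rw [Finset.sum_range_succ]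
      have := one_div_mul_sqrt_succ_le (Nat.succ_pos H)
      simp only [Nat.succ_eq_add_one] at this
      linarith
  rcases H with _ | H
  · simp
  · refine (key H).trans ?_
    have : 0 ≤ 2 / √((H + 1 : ℕ) : ℝ) := by positivity
    linarith

/-- A majorant of `min (2, 2 π h / K) / h ^ (3 / 2)`. -/
noncomputable def weight (K h : ℕ) : ℝ :=
  if h ≤ K then 2 * Real.pi / K * (1 / √(h : ℝ)) else 2 * (1 / ((h : ℝ) * √(h : ℝ)))

/-- Frequencies up to `K` contribute `4π / √K`, the others `4 / √K`. -/
lemma sum_weight_le {K : ℕ} (hK : 0 < K) (H : ℕ) :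
    ∑ h ∈ Finset.range H, weight K (h + 1) ≤ (4 * Real.pi + 4) / √(K : ℝ) := by
  have hpi := Real.pi_pos
  have hKs : 0 < √(K : ℝ) := Real.sqrt_pos.mpr (by positivity)
  have hKK := Real.mul_self_sqrt (Nat.cast_nonneg (α := ℝ) K)
  have hK' : (0 : ℝ) < K := by positivity
  have key1 : ∀ H ≤ K, ∑ h ∈ Finset.range H, weight K (h + 1) ≤ 4 * Real.pi / K * √(H : ℝ) := by
    intro H
    induction H with
    | zero => simp
    | succ H ih =>
      intro hH
      rw [Finset.sum_range_succ, weight, if_pos hH]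
      have h1 := ih (by omega)
      have h2 : 2 * Real.pi / K * (1 / √((H + 1 : ℕ) : ℝ)) ≤
        2 * Real.pi / K * (2 * (√((H + 1 : ℕ) : ℝ) - √(H : ℝ))) :=
        mul_le_mul_of_nonneg_left (one_div_sqrt_succ_le H) (by positivity)
      have e : 4 * Real.pi / K = 2 * (2 * Real.pi / K) := by ring
      rw [e] at h1 ⊢
      linarith
  have hKe : 4 * Real.pi / K * √(K : ℝ) = 4 * Real.pi / √(K : ℝ) := by
    rw [div_mul_eq_mul_div, div_eq_div_iff hK'.ne' hKs.ne', mul_assoc, hKK]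
  have key2 : ∀ j, ∑ h ∈ Finset.range (K + j), weight K (h + 1) ≤
      (4 * Real.pi + 4) / √(K : ℝ) - 4 / √((K + j : ℕ) : ℝ) := by
    intro j
    induction j with
    | zero =>
      refine (key1 K le_rfl).trans ?_
      rw [hKe, add_zero, ← sub_div, add_sub_cancel_right]
    | succ j ih =>
      rw [← add_assoc, Finset.sum_range_succ, weight, if_neg (by omega)]
      have := one_div_mul_sqrt_succ_le (k := K + j) (by omega)
      have e1 : 4 / √((K + j : ℕ) : ℝ) = 2 * (2 / √((K + j : ℕ) : ℝ)) := by ring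
      have e2 : 4 / √((K + j + 1 : ℕ) : ℝ) = 2 * (2 / √((K + j + 1 : ℕ) : ℝ)) := by ring
      rw [e1] at ih
      rw [e2]
      linarith
  rcases le_total H K with h | h
  · refine (key1 H h).trans ?_
    have : 4 * Real.pi / K * √(H : ℝ) ≤ 4 * Real.pi / K * √(K : ℝ) := by gcongr
    refine this.trans ?_
    rw [hKe]
    gcongr
    linarith
  · obtain ⟨j, rfl⟩ := Nat.exists_eq_add_of_le h
    refine (key2 j).trans ?_
    have : 0 ≤ 4 / √((K + j : ℕ) : ℝ) := by positivity
    linarith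

lemma norm_expi_sub_one_div_le {K h : ℕ} (hK : 0 < K) (hh : 0 < h) {s : ℝ} (hs : |s| = 1 / K) :
    1 / (h : ℝ) ^ 2 * (‖expi (h * s) - 1‖ * √(h : ℝ)) ≤ weight K h := by
  have hh' : (0 : ℝ) < h := by positivity
  have hhs : 0 < √(h : ℝ) := Real.sqrt_pos.mpr hh'
  have hhh := Real.mul_self_sqrt hh'.le
  have e : 1 / (h : ℝ) ^ 2 * √(h : ℝ) = 1 / ((h : ℝ) * √(h : ℝ)) := by
    rw [div_mul_eq_mul_div, one_mul, div_eq_div_iff (by positivity) (by positivity)]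
    linear_combination (h : ℝ) * hhh
  rw [mul_comm ‖_‖, ← mul_assoc, e]
  have hb : ‖expi (h * s) - 1‖ ≤ 2 * Real.pi * (h / K) := by
    refine (norm_expi_sub_one_le _).trans (le_of_eq ?_)
    rw [abs_mul, hs, abs_of_pos hh']
    ring
  have hb2 : ‖expi (h * s) - 1‖ ≤ 2 := by
    refine (norm_sub_le _ _).trans ?_
    rw [norm_expi]; norm_num
  unfold weight
  split_ifs
  · refine (mul_le_mul_of_nonneg_left hb (by positivity)).trans (le_of_eq ?_)
    field_simp
  · refine (mul_le_mul_of_nonneg_left hb2 (by positivity)).trans (le_of_eq ?_)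
    ring

/-- At frequency `k` the second differences lie in `[k lam, 2 k lam]`. The term of size `√(k lam) N`
is summed with `weight`; for the term `7 / √(k lam)` the Lipschitz bound on `expi` alone gives a
convergent sum. The factor `K / 2` is `1 / (2Δ)` with `Δ = 1 / K`. -/
lemma abs_sum_bernTwo_le_of_second_diff (x : ℕ → ℝ) (N : ℕ) {lam : ℝ} (hlam : 0 < lam)
    (hlow : ∀ n, n + 2 < N → lam ≤ x (n + 2) - 2 * x (n + 1) + x n)
    (hup : ∀ n, n + 2 < N → x (n + 2) - 2 * x (n + 1) + x n ≤ 2 * lam)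
    {K : ℕ} (hK : 0 < K) {s : ℝ} (hs : |s| = 1 / K) :
    K / 2 * |∑ n ∈ Finset.range N, (bernTwo (x n + s) - bernTwo (x n))| ≤
      16 / 3 * √lam * √(K : ℝ) * N + 7 / √lam := by
  have hpi := Real.pi_pos
  have hK' : (0 : ℝ) < K := by positivity
  have hKs : 0 < √(K : ℝ) := Real.sqrt_pos.mpr (by positivity)
  have hKK := Real.mul_self_sqrt hK'.le
  have hls : 0 < √lam := Real.sqrt_pos.mpr hlam
  have key := abs_sum_bernTwo_le x N s
    (6 * √lam * N * ((4 * Real.pi + 4) / √(K : ℝ)) + 7 / √lam * (2 * Real.pi / K) * 3) (by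
    intro H
    refine le_trans ?_ (add_le_add
      (mul_le_mul_of_nonneg_left (sum_weight_le hK H) (by positivity))
      (mul_le_mul_of_nonneg_left (sum_one_div_mul_sqrt_le H) (by positivity)))
    rw [Finset.mul_sum, Finset.mul_sum, ← Finset.sum_add_distrib]
    refine Finset.sum_le_sum fun h _ => ?_
    have hk : 0 < h + 1 := h.succ_pos
    generalize h + 1 = k at *
    have hk' : (0 : ℝ) < k := by positivity
    have hks : 0 < √(k : ℝ) := Real.sqrt_pos.mpr hk'
    have hkk := Real.mul_self_sqrt hk'.le
    have hS := norm_sum_expi_le_of_second_diff (fun n => k * x n) N (μ := k * lam) (by positivity)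
      (fun n hn => by
        have := mul_le_mul_of_nonneg_left (hlow n hn) hk'.le
        linarith)
      (fun n hn => by
        have := mul_le_mul_of_nonneg_left (hup n hn) hk'.le
        linarith)
    rw [Real.sqrt_mul hk'.le] at hS
    have hb : ‖expi (k * s) - 1‖ ≤ 2 * Real.pi * (k / K) := by
      refine (norm_expi_sub_one_le _).trans (le_of_eq ?_)
      rw [abs_mul, hs, abs_of_pos hk']
      ring
    calc _ ≤ 1 / (k : ℝ) ^ 2 * (‖expi (k * s) - 1‖ *
          (6 * (√(k : ℝ) * √lam) * N + 7 / (√(k : ℝ) * √lam))) := by gcongr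
      _ = 6 * √lam * N * (1 / (k : ℝ) ^ 2 * (‖expi (k * s) - 1‖ * √(k : ℝ))) +
          1 / (k : ℝ) ^ 2 * (‖expi (k * s) - 1‖ * (7 / (√(k : ℝ) * √lam))) := by ring
      _ ≤ 6 * √lam * N * weight K k +
          1 / (k : ℝ) ^ 2 * (2 * Real.pi * (k / K) * (7 / (√(k : ℝ) * √lam))) := by
        gcongr
        exact norm_expi_sub_one_div_le hK hk hs
      _ = _ := by
        congr 1
        field_simp)
  set T := |∑ n ∈ Finset.range N, (bernTwo (x n + s) - bernTwo (x n))| with hT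
  -- Equivalent to `6 (2π + 2) ≤ (16/3) π²`, the source of the constant `16/3`.
  have hpi2 : 18 * Real.pi + 18 ≤ 8 * Real.pi ^ 2 := by nlinarith [Real.pi_gt_d2]
  have hpi3 := Real.pi_gt_three
  have e1 : (K : ℝ) / 2 * (6 * √lam * N * ((4 * Real.pi + 4) / √(K : ℝ))) =
      6 * √lam * N * √(K : ℝ) * (2 * Real.pi + 2) := by
    nth_rewrite 1 [← hKK]
    field_simp
    ring
  have e2 : (K : ℝ) / 2 * (7 / √lam * (2 * Real.pi / K) * 3) = 7 / √lam * (3 * Real.pi) := by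
    field_simp
  have h3 := mul_le_mul_of_nonneg_left key (by positivity : (0 : ℝ) ≤ K / 2)
  rw [mul_add, e1, e2] at h3
  have h4 : 6 * √lam * N * √(K : ℝ) * (2 * Real.pi + 2) ≤
      6 * √lam * N * √(K : ℝ) * (8 / 9 * Real.pi ^ 2) := by
    gcongr
    linarith
  have h5 : 7 / √lam * (3 * Real.pi) ≤ 7 / √lam * Real.pi ^ 2 := by
    gcongr
    nlinarith
  have h6 : Real.pi ^ 2 * (K / 2 * T) ≤
      Real.pi ^ 2 * (16 / 3 * √lam * √(K : ℝ) * N + 7 / √lam) := by linarith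
  exact le_of_mul_le_mul_left h6 (by positivity)

/-- The sawtooth sum along a sequence whose second differences lie in `[l ^ 3, 2 * l ^ 3]`. -/
lemma abs_sum_sawtooth_le_of_second_diff (x : ℕ → ℝ) (N : ℕ) {l : ℝ} (hl : 0 < l)
    (hl2 : l ≤ 1 / 12)
    (hlow : ∀ n, n + 2 < N → l ^ 3 ≤ x (n + 2) - 2 * x (n + 1) + x n)
    (hup : ∀ n, n + 2 < N → x (n + 2) - 2 * x (n + 1) + x n ≤ 2 * l ^ 3) :
    |∑ n ∈ Finset.range N, sawtooth (x n)| ≤ 6 * l * N + 7 / √(l ^ 3) := by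
  -- The window `1 / K` is about `3 l`, balancing the smoothing loss `N / (2K)` against `√(l³ K) N`.
  -- As `K l ≤ 1/3 + 1/12 < 4/9`, the coefficient of `l N` is at most `3/2 + (16/3)(2/3) < 6`.
  obtain ⟨K, hK⟩ : ∃ K : ℕ, K = ⌈1 / (3 * l)⌉₊ := ⟨_, rfl⟩
  have hK1 : 1 / (3 * l) ≤ K := by rw [hK]; exact Nat.le_ceil _
  have hK2 : (K : ℝ) < 1 / (3 * l) + 1 := by rw [hK]; exact Nat.ceil_lt_add_one (by positivity)
  have hK0 : 0 < K := by
    have : (0 : ℝ) < K := lt_of_lt_of_le (by positivity) hK1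
    exact_mod_cast this
  have hK0' : (0 : ℝ) < K := by positivity
  have hK1' : (1 : ℝ) ≤ K := by exact_mod_cast hK0
  have hinv : 1 / (K : ℝ) ≤ 3 * l := by
    rw [div_le_iff₀ (by positivity)] at hK1 ⊢
    linarith
  have hKl : (K : ℝ) * l ≤ 4 / 9 := by
    have := mul_lt_mul_of_pos_right hK2 hl
    have e : (1 / (3 * l) + 1) * l = 1 / 3 + l := by field_simp
    linarith
  have hsq : √(l ^ 3) * √(K : ℝ) ≤ 2 / 3 * l := by
    rw [← Real.sqrt_mul (by positivity)]
    apply Real.sqrt_le_iff.mpr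
    refine ⟨by positivity, ?_⟩
    have : l ^ 2 * (K * l) ≤ l ^ 2 * (4 / 9) := by gcongr
    nlinarith
  have hN : (0 : ℝ) ≤ N := N.cast_nonneg
  have hΔ1 : 1 / (K : ℝ) ≤ 1 := by rw [div_le_one hK0']; exact hK1'
  have hΔ0 : 0 < 1 / (K : ℝ) := by positivity
  have hmain : ∀ s : ℝ, |s| = 1 / K →
      N * (1 / (K : ℝ) / 2) + K / 2 * |∑ n ∈ Finset.range N, (bernTwo (x n + s) - bernTwo (x n))| ≤
        6 * l * N + 7 / √(l ^ 3) := by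
    intro s hs
    have h := abs_sum_bernTwo_le_of_second_diff x N (by positivity : 0 < l ^ 3) hlow hup hK0 hs
    have h2 : 16 / 3 * √(l ^ 3) * √(K : ℝ) * N ≤ 16 / 3 * (2 / 3 * l) * N := by
      have := mul_le_mul_of_nonneg_right hsq hN
      linarith
    have h3 : N * (1 / (K : ℝ) / 2) ≤ N * (3 * l / 2) := by gcongr
    have h4 : 0 ≤ l * N := by positivity
    nlinarith
  have hKd : ∀ y : ℝ, y / (2 * (1 / (K : ℝ))) = K / 2 * y := fun y => by field_simp
  rw [abs_le]
  constructor
  · have h := hmain (1 / K) (abs_of_pos hΔ0)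
    have h1 : ∑ n ∈ Finset.range N, (-(1 / (K : ℝ) / 2) +
        K / 2 * (bernTwo (x n + 1 / K) - bernTwo (x n))) ≤
        ∑ n ∈ Finset.range N, sawtooth (x n) := by
      refine Finset.sum_le_sum fun n _ => ?_
      rw [← hKd]
      exact le_sawtooth hΔ0 hΔ1 (x n)
    rw [Finset.sum_add_distrib, Finset.sum_const, Finset.card_range, nsmul_eq_mul,
      ← Finset.mul_sum] at h1
    have h2 := mul_le_mul_of_nonneg_left
      (neg_abs_le (∑ n ∈ Finset.range N, (bernTwo (x n + 1 / K) - bernTwo (x n))))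
      (by positivity : (0 : ℝ) ≤ K / 2)
    linarith
  · have h := hmain (-(1 / K)) (by rw [abs_neg]; exact abs_of_pos hΔ0)
    have h1 : ∑ n ∈ Finset.range N, sawtooth (x n) ≤
        ∑ n ∈ Finset.range N, (1 / (K : ℝ) / 2 -
        K / 2 * (bernTwo (x n + -(1 / K)) - bernTwo (x n))) := by
      refine Finset.sum_le_sum fun n _ => ?_
      refine (sawtooth_le hΔ0 hΔ1 (x n)).trans (le_of_eq ?_)
      rw [hKd]
      ring
    rw [Finset.sum_sub_distrib, Finset.sum_const, Finset.card_range, nsmul_eq_mul,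
      ← Finset.mul_sum] at h1
    have h2 := mul_le_mul_of_nonneg_left
      (neg_abs_le (∑ n ∈ Finset.range N, (bernTwo (x n + -(1 / K)) - bernTwo (x n))))
      (by positivity : (0 : ℝ) ≤ K / 2)
    linarith

/-! ### Dyadic blocks and the passage from sequences to functions. -/

/-- Sawtooth sums along a sequence whose second differences are controlled by an increasing
positive sequence `c`. -/
lemma abs_sum_sawtooth_le_of_monotone (N : ℕ) : ∀ (x c : ℕ → ℝ), 0 < N →
    (∀ n < N, 0 < c n) → (∀ n, n + 1 < N → c n ≤ c (n + 1)) →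
    (∀ n, n + 2 < N → c n ≤ x (n + 2) - 2 * x (n + 1) + x n ∧
      x (n + 2) - 2 * x (n + 1) + x n ≤ c (n + 2)) →
    |∑ n ∈ Finset.range N, sawtooth (x n)| ≤
      6 * ∑ n ∈ Finset.range N, c n ^ (1 / 3 : ℝ) + 28 / √(c 0) := by
  induction N using Nat.strong_induction_on with
  | _ N ih =>
  intro x c hN hpos hmono hdiff
  have hc0 : 0 < c 0 := hpos 0 hN
  have hmono0 : ∀ n < N, c 0 ≤ c n := by
    intro n
    induction n with
    | zero => simp
    | succ n ihn =>
      intro hn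
      exact (ihn (by omega)).trans (hmono n hn)
  set l : ℝ := c 0 ^ (1 / 3 : ℝ) with hl
  have hl0 : 0 < l := Real.rpow_pos_of_pos hc0 _
  have hl3 : l ^ 3 = c 0 := by
    rw [hl, ← Real.rpow_natCast, ← Real.rpow_mul hc0.le]
    norm_num
  have hlc : ∀ n < N, l ≤ c n ^ (1 / 3 : ℝ) := fun n hn =>
    Real.rpow_le_rpow hc0.le (hmono0 n hn) (by norm_num)
  -- If `l ≥ 1/12`, the trivial bound `1/2` per term is at most `6 * c n ^ (1/3)`.
  rcases le_total (1 / 12) l with h12 | h12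
  · refine (abs_sum_sawtooth_le _ _).trans ?_
    have h1 : ∑ n ∈ Finset.range N, (1 / 12 : ℝ) ≤ ∑ n ∈ Finset.range N, c n ^ (1 / 3 : ℝ) :=
      Finset.sum_le_sum fun n hn => h12.trans (hlc n (Finset.mem_range.mp hn))
    rw [Finset.sum_const, nsmul_eq_mul] at h1
    have : 0 ≤ 28 / √(c 0) := by positivity
    linarith
  -- The first block ends where `c` has doubled; induction handles the rest.
  obtain ⟨k, hk, h1, h2⟩ := exists_initial_segment c N hmono (2 * c 0)
  have hk0 : 0 < k := by
    by_contra h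
    have := h2 0 (by omega) hN
    linarith
  obtain ⟨j, rfl⟩ := Nat.exists_eq_add_of_le hk
  have hA := abs_sum_sawtooth_le_of_second_diff x k hl0 h12
    (fun n hn => by
      rw [hl3]
      exact (hmono0 n (by omega)).trans (hdiff n (by omega)).1)
    (fun n hn => by
      rw [hl3]
      exact (hdiff n (by omega)).2.trans (h1 (n + 2) hn).le)
  rw [hl3] at hA
  have hA2 : l * k ≤ ∑ n ∈ Finset.range k, c n ^ (1 / 3 : ℝ) := by
    have h1 : ∑ n ∈ Finset.range k, l ≤ ∑ n ∈ Finset.range k, c n ^ (1 / 3 : ℝ) :=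
      Finset.sum_le_sum fun n hn => hlc n (by have := Finset.mem_range.mp hn; omega)
    rw [Finset.sum_const, nsmul_eq_mul, Finset.card_range] at h1
    linarith
  have hs0 : 0 < √(c 0) := Real.sqrt_pos.mpr hc0
  rw [Finset.sum_range_add, Finset.sum_range_add]
  have e7 : 28 / √(c 0) = 7 / √(c 0) + 21 / √(c 0) := by rw [← add_div]; norm_num
  rcases Nat.eq_zero_or_pos j with rfl | hj
  · have : 0 ≤ 21 / √(c 0) := by positivity
    simp only [Finset.range_zero, Finset.sum_empty, add_zero]
    linarith
  have hB := ih j (by omega) (fun n => x (k + n)) (fun n => c (k + n)) hj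
    (fun n hn => hpos _ (by omega)) (fun n hn => hmono (k + n) (by omega))
    (fun n hn => hdiff (k + n) (by omega))
  have hck : 2 * c 0 ≤ c k := h2 k le_rfl (by omega)
  -- Since `√2 ≥ 4/3`, the remainder costs at most `28 * (3/4) = 21` units, and `7 + 21 = 28` closes
  -- the induction.
  have hsk : 4 / 3 * √(c 0) ≤ √(c k) := by
    apply Real.le_sqrt_of_sq_le
    rw [mul_pow, Real.sq_sqrt hc0.le]
    linarith
  have h28 : 28 / √(c k) ≤ 21 / √(c 0) := by
    rw [div_le_div_iff₀ (by linarith) hs0]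
    linarith
  simp only [add_zero] at hB
  have := abs_add_le (∑ n ∈ Finset.range k, sawtooth (x n))
    (∑ n ∈ Finset.range j, sawtooth (x (k + n)))
  linarith

/-- Giving up the last term leaves `N` cube roots at `N + 1` points, a one-sided Riemann sum that
lies below an integral. -/
lemma abs_sum_sawtooth_succ_le_of_monotone (N : ℕ) (x c : ℕ → ℝ)
    (hpos : ∀ n < N + 1, 0 < c n) (hmono : ∀ n, n + 1 < N + 1 → c n ≤ c (n + 1))
    (hdiff : ∀ n, n + 2 < N + 1 → c n ≤ x (n + 2) - 2 * x (n + 1) + x n ∧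
      x (n + 2) - 2 * x (n + 1) + x n ≤ c (n + 2)) :
    |∑ n ∈ Finset.range (N + 1), sawtooth (x n)| ≤
      6 * ∑ n ∈ Finset.range N, c n ^ (1 / 3 : ℝ) + 28 / √(c 0) + 1 / 2 := by
  rw [Finset.sum_range_succ]
  refine (abs_add_le _ _).trans (add_le_add ?_ (abs_sawtooth_le _))
  rcases Nat.eq_zero_or_pos N with rfl | hN
  · simp only [Finset.range_zero, Finset.sum_empty, abs_zero, mul_zero, zero_add]
    positivity
  · exact abs_sum_sawtooth_le_of_monotone N x c hN (fun n hn => hpos n (by omega))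
      (fun n hn => hmono n (by omega)) (fun n hn => hdiff n (by omega))

/-- The mean value theorem for `h (x + 1) - h x`, then for `h1`. -/
lemma exists_second_diff_eq {h h1 h2 : ℝ → ℝ} {y : ℝ} (hc : ContinuousOn h (Icc y (y + 2)))
    (hc1 : ContinuousOn h1 (Icc y (y + 2)))
    (hd : ∀ x ∈ Ioo y (y + 2), HasDerivAt h (h1 x) x)
    (hd1 : ∀ x ∈ Ioo y (y + 2), HasDerivAt h1 (h2 x) x) :
    ∃ ξ ∈ Ioo y (y + 2), h (y + 2) - 2 * h (y + 1) + h y = h2 ξ := by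
  obtain ⟨z, hz, hz'⟩ := exists_hasDerivAt_eq_slope (fun x => h (x + 1) - h x)
    (fun x => h1 (x + 1) - h1 x) (by linarith : y < y + 1)
    (by
      refine ContinuousOn.sub (hc.comp (by fun_prop) ?_) (hc.mono ?_)
      · intro x hx
        exact ⟨by linarith [hx.1], by linarith [hx.2]⟩
      · intro x hx
        exact ⟨by linarith [hx.1], by linarith [hx.2]⟩)
    (by
      intro x hx
      refine HasDerivAt.sub ?_ (hd x ⟨hx.1, by linarith [hx.2]⟩)
      exact (hd (x + 1) ⟨by linarith [hx.1], by linarith [hx.2]⟩).comp_add_const x 1)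
  obtain ⟨ξ, hξ, hξ'⟩ := exists_hasDerivAt_eq_slope h1 h2 (by linarith : z < z + 1)
    (hc1.mono fun x hx => ⟨by linarith [hx.1, hz.1], by linarith [hx.2, hz.2]⟩)
    (fun x hx => hd1 x ⟨by linarith [hx.1, hz.1], by linarith [hx.2, hz.2]⟩)
  refine ⟨ξ, ⟨by linarith [hξ.1, hz.1], by linarith [hξ.2, hz.2]⟩, ?_⟩
  rw [hξ']
  simp only [add_sub_cancel_left, div_one] at hz' ⊢
  rw [hz', show y + 1 + 1 = y + 2 by ring]
  ring

lemma sum_Ioc_eq_sum_range' {A : Type*} [AddCommMonoid A] (F : ℕ → A) (p q : ℕ) :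
    ∑ n ∈ Finset.Ioc p q, F n = ∑ i ∈ Finset.range (q - p), F (p + 1 + i) := by
  have : Finset.Ioc p q = Finset.Ico (p + 1) (q + 1) := by
    ext; simp only [Finset.mem_Ioc, Finset.mem_Ico]; omega
  rw [this, Finset.sum_Ico_eq_sum_range]
  congr 2
  omega

/-- Sawtooth sum over the integers of an interval on which the second derivative is monotone. -/
lemma abs_sum_sawtooth_le_integral {h h1 h2 : ℝ → ℝ} {u c : ℝ} (hu : 0 ≤ u) (huc : u < c)
    (hc : ContinuousOn h (Icc u c)) (hc1 : ContinuousOn h1 (Icc u c))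
    (hc2 : ContinuousOn h2 (Icc u c))
    (hd : ∀ x ∈ Ioo u c, HasDerivAt h (h1 x) x)
    (hd1 : ∀ x ∈ Ioo u c, HasDerivAt h1 (h2 x) x)
    (hpos : ∀ x ∈ Icc u c, 0 < h2 x)
    (hmon : MonotoneOn h2 (Icc u c) ∨ AntitoneOn h2 (Icc u c)) :
    |∑ n ∈ Finset.Ioc ⌊u⌋₊ ⌊c⌋₊, sawtooth (h n)| ≤
      6 * (∫ x in u..c, h2 x ^ (1 / 3 : ℝ)) + 28 / √(h2 u) + 28 / √(h2 c) + 1 / 2 := by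
  have hint0 : 0 ≤ ∫ x in u..c, h2 x ^ (1 / 3 : ℝ) :=
    intervalIntegral.integral_nonneg huc.le fun x hx => Real.rpow_nonneg (hpos x hx).le _
  have hu28 : 0 ≤ 28 / √(h2 u) := by positivity
  have hc28 : 0 ≤ 28 / √(h2 c) := by positivity
  rw [sum_Ioc_eq_sum_range']
  set p := ⌊u⌋₊ with hp
  rcases Nat.eq_zero_or_pos (⌊c⌋₊ - p) with h0 | h0
  · rw [h0]
    simp only [Finset.range_zero, Finset.sum_empty, abs_zero]
    linarith
  obtain ⟨N, hN⟩ : ∃ N, ⌊c⌋₊ - p = N + 1 := ⟨⌊c⌋₊ - p - 1, by omega⟩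
  rw [hN]
  have hpu : u < (p : ℝ) + 1 := Nat.lt_floor_add_one u
  have hpc : ((p : ℝ) + 1) + N ≤ c := by
    have h1 : ((⌊c⌋₊ : ℕ) : ℝ) ≤ c := Nat.floor_le (by linarith)
    have h2 : ((p + 1 + N : ℕ) : ℝ) ≤ c := by
      have : p + 1 + N = ⌊c⌋₊ := by omega
      rw [this]; exact h1
    push_cast at h2
    exact h2
  set j : ℝ := (p : ℝ) + 1 with hj
  have hmem : ∀ n : ℕ, n ≤ N → j + n ∈ Icc u c := fun n hn => by
    have : (n : ℝ) ≤ N := by exact_mod_cast hn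
    have h0 : (0 : ℝ) ≤ n := n.cast_nonneg
    exact ⟨by linarith, by linarith⟩
  have hsub : Icc j (j + N) ⊆ Icc u c := Icc_subset_Icc hpu.le hpc
  have hcont : ContinuousOn (fun x => h2 x ^ (1 / 3 : ℝ)) (Icc u c) :=
    hc2.rpow_const fun x hx => Or.inr (by norm_num)
  have hintle : ∫ x in j..j + N, h2 x ^ (1 / 3 : ℝ) ≤ ∫ x in u..c, h2 x ^ (1 / 3 : ℝ) := by
    refine intervalIntegral.integral_mono_interval hpu.le ?_ hpc ?_ ?_
    · linarith [(N.cast_nonneg : (0 : ℝ) ≤ N)]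
    · refine (ae_restrict_iff' measurableSet_Ioc).mpr (Filter.Eventually.of_forall fun x hx => ?_)
      exact Real.rpow_nonneg (hpos x ⟨hx.1.le, hx.2⟩).le _
    · exact hcont.intervalIntegrable_of_Icc huc.le
  have hdiff : ∀ n : ℕ, n + 2 < N + 1 → ∃ ξ ∈ Ioo (j + n) (j + (n + 2 : ℕ)),
      h (j + (n + 2 : ℕ)) - 2 * h (j + (n + 1 : ℕ)) + h (j + n) = h2 ξ := by
    intro n hn
    have a := hmem n (by omega)
    have b := hmem (n + 2) (by omega)
    push_cast at b ⊢
    simp only [← add_assoc] at b ⊢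
    have hs : Icc (j + n) (j + n + 2) ⊆ Icc u c := Icc_subset_Icc a.1 b.2
    have hs2 : Ioo (j + n) (j + n + 2) ⊆ Ioo u c := Ioo_subset_Ioo a.1 b.2
    exact exists_second_diff_eq (hc.mono hs) (hc1.mono hs) (fun x hx => hd x (hs2 hx))
      (fun x hx => hd1 x (hs2 hx))
  have hcast : ∀ n : ℕ, ((p + 1 + n : ℕ) : ℝ) = j + n := fun n => by push_cast; rfl
  simp only [hcast]
  rcases hmon with hm | hm
  · have key := abs_sum_sawtooth_succ_le_of_monotone N (fun n => h (j + n)) (fun n => h2 (j + n))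
      (fun n hn => hpos _ (hmem n (by omega)))
      (fun n hn => hm (hmem n (by omega)) (hmem (n + 1) (by omega)) (by push_cast; linarith))
      (fun n hn => by
        obtain ⟨ξ, hξ, e⟩ := hdiff n hn
        have a := hmem n (by omega)
        have b := hmem (n + 2) (by omega)
        have hξ' : ξ ∈ Icc u c := ⟨a.1.trans hξ.1.le, hξ.2.le.trans b.2⟩
        rw [e]
        exact ⟨hm a hξ' hξ.1.le, hm hξ' b hξ.2.le⟩)
    have hsum := MonotoneOn.sum_le_integral (x₀ := j) (a := N)
      (f := fun x => h2 x ^ (1 / 3 : ℝ)) (fun x hx y hy hxy =>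
        Real.rpow_le_rpow (hpos x (hsub hx)).le (hm (hsub hx) (hsub hy) hxy) (by norm_num))
    have h28 : 28 / √(h2 (j + (0 : ℕ))) ≤ 28 / √(h2 u) := by
      have hu0 := hpos u ⟨le_rfl, huc.le⟩
      have : h2 u ≤ h2 (j + (0 : ℕ)) := hm ⟨le_rfl, huc.le⟩ (hmem 0 (by omega)) (hmem 0 (by omega)).1
      have := Real.sqrt_le_sqrt this
      have := Real.sqrt_pos.mpr hu0
      gcongr
    linarith
  -- Second differences are invariant under reversal, so the decreasing case is read backwards.
  · have key := abs_sum_sawtooth_succ_le_of_monotone N (fun n => h (j + (N - n : ℕ)))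
      (fun n => h2 (j + (N - n : ℕ)))
      (fun n hn => hpos _ (hmem _ (by omega)))
      (fun n hn => hm (hmem _ (by omega)) (hmem _ (by omega)) (by
        have : N - (n + 1) ≤ N - n := by omega
        gcongr))
      (fun n hn => by
        obtain ⟨ξ, hξ, e⟩ := hdiff (N - (n + 2)) (by omega)
        have a := hmem (N - (n + 2)) (by omega)
        have b := hmem (N - (n + 2) + 2) (by omega)
        have hξ' : ξ ∈ Icc u c := ⟨a.1.trans hξ.1.le, hξ.2.le.trans b.2⟩
        have e1 : N - (n + 2) + 2 = N - n := by omega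
        have e2 : N - (n + 2) + 1 = N - (n + 1) := by omega
        rw [e1] at hξ b e
        rw [e2] at e
        have e3 : h (j + (N - (n + 2) : ℕ)) - 2 * h (j + (N - (n + 1) : ℕ)) + h (j + (N - n : ℕ)) =
          h2 ξ := by linarith
        rw [e3]
        exact ⟨hm hξ' b hξ.2.le, hm a hξ' hξ.1.le⟩)
    have hsum := AntitoneOn.sum_le_integral (x₀ := j) (a := N)
      (f := fun x => h2 x ^ (1 / 3 : ℝ)) (fun x hx y hy hxy =>
        Real.rpow_le_rpow (hpos y (hsub hy)).le (hm (hsub hx) (hsub hy) hxy) (by norm_num))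
    have h28 : 28 / √(h2 (j + (N - 0 : ℕ))) ≤ 28 / √(h2 c) := by
      have hu0 := hpos c ⟨huc.le, le_rfl⟩
      have : h2 c ≤ h2 (j + (N - 0 : ℕ)) :=
        hm (hmem _ (by omega)) ⟨huc.le, le_rfl⟩ (hmem _ (by omega)).2
      have := Real.sqrt_le_sqrt this
      have := Real.sqrt_pos.mpr hu0
      gcongr
    have r1 : ∑ n ∈ Finset.range (N + 1), sawtooth (h (j + (N - n : ℕ))) =
        ∑ n ∈ Finset.range (N + 1), sawtooth (h (j + n)) := by
      rw [← Finset.sum_range_reflect]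
      refine Finset.sum_congr rfl fun n hn => ?_
      have := Finset.mem_range.mp hn
      rw [show N - (N + 1 - 1 - n) = n by omega]
    have r2 : ∑ n ∈ Finset.range N, h2 (j + (N - n : ℕ)) ^ (1 / 3 : ℝ) =
        ∑ n ∈ Finset.range N, h2 (j + (n + 1 : ℕ)) ^ (1 / 3 : ℝ) := by
      rw [← Finset.sum_range_reflect]
      refine Finset.sum_congr rfl fun n hn => ?_
      have := Finset.mem_range.mp hn
      rw [show N - (N - 1 - n) = n + 1 by omega]
    rw [r1, r2] at key
    linarith

lemma monotoneOn_Icc_of_Ioo {h : ℝ → ℝ} {u c : ℝ} (hc : ContinuousOn h (Icc u c))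
    (hm : MonotoneOn h (Ioo u c)) : MonotoneOn h (Icc u c) := by
  have step : ∀ y ∈ Ioo u c, ∀ x ∈ Icc u y, h x ≤ h y := by
    intro y hy x hx
    have hcl : x ∈ closure (Ioo u y) := by rwa [closure_Ioo hy.1.ne]
    refine ContinuousWithinAt.closure_le hcl ((hc x ⟨hx.1, hx.2.trans hy.2.le⟩).mono ?_)
      continuousWithinAt_const fun z hz => hm ⟨hz.1, hz.2.trans hy.2⟩ hy hz.2.le
    exact Ioo_subset_Icc_self.trans (Icc_subset_Icc_right hy.2.le)
  intro x hx y hy hxy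
  rcases hxy.eq_or_lt with rfl | hxy
  · exact le_rfl
  have hxc : x < c := hxy.trans_le hy.2
  have hcl : y ∈ closure (Ioo x c) := by rw [closure_Ioo hxc.ne]; exact ⟨hxy.le, hy.2⟩
  refine ContinuousWithinAt.closure_le hcl continuousWithinAt_const ((hc y hy).mono ?_)
    fun z hz => step z ⟨hx.1.trans_lt hz.1, hz.2⟩ x ⟨hx.1, hz.1.le⟩
  exact Ioo_subset_Icc_self.trans (Icc_subset_Icc_left hx.1)

lemma antitoneOn_Icc_of_Ioo {h : ℝ → ℝ} {u c : ℝ} (hc : ContinuousOn h (Icc u c))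
    (hm : AntitoneOn h (Ioo u c)) : AntitoneOn h (Icc u c) := by
  have := (monotoneOn_Icc_of_Ioo (h := fun x => -h x) hc.neg hm.neg).neg
  simpa using this

/-! ### Convex arcs: sawtooth sums and Euler–Maclaurin. -/

/-- The continuous periodic antiderivative of the sawtooth. -/
noncomputable def sawtoothPrim (x : ℝ) : ℝ := (Int.fract x ^ 2 - Int.fract x) / 2

lemma continuous_sawtoothPrim : Continuous sawtoothPrim :=
  ContinuousOn.comp_fract'' (f := fun s : ℝ => (s ^ 2 - s) / 2) (by fun_prop) (by norm_num)

lemma abs_sawtoothPrim_le (x : ℝ) : |sawtoothPrim x| ≤ 1 / 8 := by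
  have h1 := Int.fract_nonneg x
  have h2 := (Int.fract_lt_one x).le
  unfold sawtoothPrim
  rw [abs_le]
  constructor <;> nlinarith [sq_nonneg (Int.fract x - 1 / 2)]

/-- The right derivative exists at integers too, and integration by parts needs no more. -/
lemma hasDerivWithinAt_sawtoothPrim (x : ℝ) :
    HasDerivWithinAt sawtoothPrim (sawtooth x) (Ioi x) x := by
  have h : HasDerivAt (fun y : ℝ => ((y - ⌊x⌋) ^ 2 - (y - ⌊x⌋)) / 2) (sawtooth x) x := by
    have h1 : HasDerivAt (fun y : ℝ => y - (⌊x⌋ : ℝ)) 1 x := (hasDerivAt_id x).sub_const _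
    refine (((h1.pow 2).sub h1).div_const 2).congr_deriv ?_
    unfold sawtooth
    rw [← Int.self_sub_floor]
    simp
    ring
  refine h.hasDerivWithinAt.congr_of_eventuallyEq ?_ ?_
  · have hlt : x < ⌊x⌋ + 1 := Int.lt_floor_add_one x
    filter_upwards [Ioo_mem_nhdsGT hlt] with y hy
    have : ⌊y⌋ = ⌊x⌋ := by
      rw [Int.floor_eq_iff]
      exact ⟨(Int.floor_le x).trans hy.1.le, hy.2⟩
    unfold sawtoothPrim
    rw [← Int.self_sub_floor, this]
  · unfold sawtoothPrim
    rw [← Int.self_sub_floor]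

lemma measurable_sawtooth : Measurable sawtooth := by
  unfold sawtooth
  exact measurable_fract.sub_const _

lemma intervalIntegrable_sawtooth (p q : ℝ) : IntervalIntegrable sawtooth volume p q := by
  rw [intervalIntegrable_iff]
  refine Measure.integrableOn_of_bounded (M := 1 / 2) (by simp)
    measurable_sawtooth.aestronglyMeasurable (Filter.Eventually.of_forall fun x => ?_)
  exact abs_sawtooth_le x

/-- An arc `h` on `[a, b]` with `h b = 0`, derivatives `h1 < 0` and `h2 > 0` on `[a, b)`, and
`h2` piecewise monotonic with respect to the partition `t`. -/
structure ArcData (h h1 h2 : ℝ → ℝ) (a b : ℝ) (m : ℕ) (t : ℕ → ℝ) : Prop where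
  nonneg : 0 ≤ a
  lt : a < b
  apply_b : h b = 0
  cont : ContinuousOn h (Icc a b)
  cont1 : ContinuousOn h1 (Ico a b)
  cont2 : ContinuousOn h2 (Ico a b)
  hasDerivAt : ∀ x ∈ Ioo a b, HasDerivAt h (h1 x) x
  hasDerivAt1 : ∀ x ∈ Ioo a b, HasDerivAt h1 (h2 x) x
  neg : ∀ x ∈ Ico a b, h1 x < 0
  pos : ∀ x ∈ Ico a b, 0 < h2 x
  first : t 0 = a
  last : t m = b
  lt_succ : ∀ i < m, t i < t (i + 1)
  monotonic : ∀ i < m, MonotoneOn h2 (Ioo (t i) (t (i + 1))) ∨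
    AntitoneOn h2 (Ioo (t i) (t (i + 1)))

namespace ArcData

variable {h h1 h2 : ℝ → ℝ} {a b : ℝ} {m : ℕ} {t : ℕ → ℝ}

lemma le_t (A : ArcData h h1 h2 a b m t) : ∀ i ≤ m, a ≤ t i := by
  intro i
  induction i with
  | zero => intro _; exact A.first.ge
  | succ i ih =>
    intro hi
    exact (ih (by omega)).trans (A.lt_succ i (by omega)).le

lemma m_pos (A : ArcData h h1 h2 a b m t) : 0 < m := by
  rcases Nat.eq_zero_or_pos m with h | h
  · have h1 := A.first
    have h2 := A.last
    rw [h] at h2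
    linarith [A.lt]
  · exact h

lemma integral_h2 (A : ArcData h h1 h2 a b m t) {p q : ℝ} (hp : a ≤ p) (hpq : p ≤ q) (hq : q < b) :
    IntervalIntegrable h2 volume p q ∧ ∫ x in p..q, h2 x = h1 q - h1 p := by
  have hs : Icc p q ⊆ Ico a b := fun x hx => ⟨hp.trans hx.1, hx.2.trans_lt hq⟩
  have hi : IntervalIntegrable h2 volume p q :=
    (A.cont2.mono hs).intervalIntegrable_of_Icc hpq
  exact ⟨hi, intervalIntegral.integral_eq_sub_of_hasDerivAt_of_le hpq (A.cont1.mono hs)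
    (fun x hx => A.hasDerivAt1 x ⟨hp.trans_lt hx.1, hx.2.trans hq⟩) hi⟩

lemma h1_mono (A : ArcData h h1 h2 a b m t) {p : ℝ} (hp : p ∈ Ico a b) : h1 a ≤ h1 p := by
  have h := (A.integral_h2 le_rfl hp.1 hp.2).2
  have : 0 ≤ ∫ x in a..p, h2 x := intervalIntegral.integral_nonneg hp.1 fun x hx =>
    (A.pos x ⟨hx.1, hx.2.trans_lt hp.2⟩).le
  linarith

/-- By `y ^ (1/3) ≤ 1 + y`, and because `∫ h2 = h1 v - h1 a < -h1 a` uniformly for `v < b`, as `h1 <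
0`. -/
lemma intervalIntegrable_rpow (A : ArcData h h1 h2 a b m t) :
    IntervalIntegrable (fun x => h2 x ^ (1 / 3 : ℝ)) volume a b := by
  rw [intervalIntegrable_iff_integrableOn_Ioc_of_le A.lt.le]
  obtain ⟨v, -, hv2, hv⟩ := exists_seq_strictMono_tendsto' A.lt
  have hcont : ContinuousOn (fun x => h2 x ^ (1 / 3 : ℝ)) (Ico a b) :=
    A.cont2.rpow_const fun x hx => Or.inr (by norm_num)
  have hii : ∀ i, IntervalIntegrable (fun x => h2 x ^ (1 / 3 : ℝ)) volume a (v i) := fun i =>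
    (hcont.mono fun x hx => ⟨hx.1, hx.2.trans_lt (hv2 i).2⟩).intervalIntegrable_of_Icc (hv2 i).1.le
  refine integrableOn_Ioc_of_intervalIntegral_norm_bounded_right (I := (b - a) - h1 a) (b := v)
    (l := Filter.atTop) (fun i => (hii i).1) hv (Filter.Eventually.of_forall fun i => ?_)
  have hi := A.integral_h2 le_rfl (hv2 i).1.le (hv2 i).2
  rw [← intervalIntegral.integral_of_le (hv2 i).1.le]
  have h3 : ∫ x in a..v i, ‖h2 x ^ (1 / 3 : ℝ)‖ ≤ ∫ x in a..v i, (1 + h2 x) := by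
    refine intervalIntegral.integral_mono_on (hv2 i).1.le (hii i).norm
      (intervalIntegrable_const.add hi.1) fun x hx => ?_
    have hx0 := (A.pos x ⟨hx.1, hx.2.trans_lt (hv2 i).2⟩).le
    rw [Real.norm_of_nonneg (Real.rpow_nonneg hx0 _)]
    rcases le_total (h2 x) 1 with h | h
    · have := Real.rpow_le_one hx0 h (by norm_num : (0 : ℝ) ≤ 1 / 3)
      linarith
    · have := Real.rpow_le_rpow_of_exponent_le h (by norm_num : (1 / 3 : ℝ) ≤ 1)
      rw [Real.rpow_one] at this
      linarith
  rw [intervalIntegral.integral_add intervalIntegrable_const hi.1, hi.2] at h3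
  simp only [intervalIntegral.integral_const, smul_eq_mul, mul_one] at h3
  have := A.neg (v i) ⟨(hv2 i).1.le, (hv2 i).2⟩
  linarith [(hv2 i).2]

/-- The sawtooth sum over the integers of `(a, w]`, for `w < b`. -/
lemma abs_sum_sawtooth_le (A : ArcData h h1 h2 a b m t) {w : ℝ} (haw : a ≤ w) (hwb : w < b) :
    |∑ n ∈ Finset.Ioc ⌊a⌋₊ ⌊w⌋₊, sawtooth (h n)| ≤
      6 * (∫ x in a..w, h2 x ^ (1 / 3 : ℝ)) + m / 2 +
        56 * ∑ i ∈ Finset.range m, 1 / √(h2 (t i)) + 28 / √(h2 w) := by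
  have hcont : ContinuousOn (fun x => h2 x ^ (1 / 3 : ℝ)) (Ico a b) :=
    A.cont2.rpow_const fun x hx => Or.inr (by norm_num)
  have key : ∀ i ≤ m, |∑ n ∈ Finset.Ioc ⌊a⌋₊ ⌊min (t i) w⌋₊, sawtooth (h n)| ≤
      6 * (∫ x in a..min (t i) w, h2 x ^ (1 / 3 : ℝ)) + (i : ℕ) / 2 +
        56 * ∑ k ∈ Finset.range i, 1 / √(h2 (t k)) + 28 / √(h2 (min (t i) w)) := by
    intro i
    induction i with
    | zero =>
      intro _
      rw [A.first, min_eq_left haw]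
      simp
      positivity
    | succ i ih =>
      intro hi
      have ih := ih (by omega)
      have hlt := A.lt_succ i (by omega)
      have hat := A.le_t i (by omega)
      rw [Finset.sum_range_succ]
      have hsq : 0 ≤ 1 / √(h2 (t i)) := by positivity
      rcases le_or_gt w (t i) with hw | hw
      · rw [min_eq_right hw] at ih
        rw [min_eq_right (hw.trans hlt.le)]
        push_cast
        linarith
      · rw [min_eq_left hw.le] at ih
        set c := min (t (i + 1)) w with hc
        have htc : t i < c := lt_min hlt hw
        have hcw : c ≤ w := min_le_right _ _
        have hcb : c < b := hcw.trans_lt hwb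
        have hs : Icc (t i) c ⊆ Ico a b := fun x hx => ⟨hat.trans hx.1, hx.2.trans_lt hcb⟩
        have hso : Ioo (t i) c ⊆ Ioo a b := fun x hx => ⟨hat.trans_lt hx.1, hx.2.trans hcb⟩
        have hst : Ioo (t i) c ⊆ Ioo (t i) (t (i + 1)) := Ioo_subset_Ioo_right (min_le_left _ _)
        have hpiece := abs_sum_sawtooth_le_integral (A.nonneg.trans hat) htc
          (A.cont.mono (hs.trans Ico_subset_Icc_self)) (A.cont1.mono hs) (A.cont2.mono hs)
          (fun x hx => A.hasDerivAt x (hso hx)) (fun x hx => A.hasDerivAt1 x (hso hx))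
          (fun x hx => A.pos x (hs hx))
          ((A.monotonic i (by omega)).imp
            (fun hm => monotoneOn_Icc_of_Ioo (A.cont2.mono hs) (hm.mono hst))
            (fun hm => antitoneOn_Icc_of_Ioo (A.cont2.mono hs) (hm.mono hst)))
        have hsplit : ∑ n ∈ Finset.Ioc ⌊a⌋₊ ⌊c⌋₊, sawtooth (h n) =
            ∑ n ∈ Finset.Ioc ⌊a⌋₊ ⌊t i⌋₊, sawtooth (h n) +
              ∑ n ∈ Finset.Ioc ⌊t i⌋₊ ⌊c⌋₊, sawtooth (h n) :=
          (Finset.sum_Ioc_consecutive _ (Nat.floor_mono hat) (Nat.floor_mono htc.le)).symm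
        have hint := intervalIntegral.integral_add_adjacent_intervals (a := a) (b := t i) (c := c)
          (μ := volume) (f := fun x => h2 x ^ (1 / 3 : ℝ))
          ((hcont.mono fun x hx => ⟨hx.1, hx.2.trans_lt (hw.trans hwb)⟩).intervalIntegrable_of_Icc
            hat)
          ((hcont.mono hs).intervalIntegrable_of_Icc htc.le)
        rw [hsplit, ← hint]
        refine (abs_add_le _ _).trans ?_
        -- The point `t i` ends one piece and starts the next, whence `56 = 28 + 28`.
        have e28 : 28 / √(h2 (t i)) = 28 * (1 / √(h2 (t i))) := by ring
        rw [e28] at ih hpiece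
        push_cast
        linarith
  have := key m le_rfl
  rwa [A.last, min_eq_right hwb.le] at this

/-- Euler–Maclaurin summation on a subinterval of `(a, b)`. -/
lemma abs_sum_sub_integral_le_aux (A : ArcData h h1 h2 a b m t) {p q : ℝ} (hp : a < p)
    (hpq : p ≤ q) (hq : q < b) :
    |∑ n ∈ Finset.Ioc ⌊p⌋₊ ⌊q⌋₊, h n - (∫ x in p..q, h x) - sawtooth p * h p +
      sawtooth q * h q| ≤ 1 / 4 * |h1 a| := by
  have hp0 : 0 ≤ p := A.nonneg.trans hp.le
  have hs : Icc p q ⊆ Ioo a b := fun x hx => ⟨hp.trans_le hx.1, hx.2.trans_lt hq⟩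
  have hs' : Icc p q ⊆ Ico a b := hs.trans Ioo_subset_Ico_self
  have hmem : ∀ x ∈ Ioo (min p q) (max p q), x ∈ Ioo a b := fun x hx => by
    rw [min_eq_left hpq, max_eq_right hpq] at hx
    exact hs (Ioo_subset_Icc_self hx)
  have hc : ContinuousOn h (Icc p q) := A.cont.mono (hs'.trans Ico_subset_Icc_self)
  have hc1 : ContinuousOn h1 (Icc p q) := A.cont1.mono hs'
  have hi1 : IntervalIntegrable h1 volume p q := hc1.intervalIntegrable_of_Icc hpq
  have hderiv : ∀ x ∈ Icc p q, deriv h x = h1 x := fun x hx => (A.hasDerivAt x (hs hx)).deriv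
  have abel := sum_mul_eq_sub_sub_integral_mul (fun _ => (1 : ℝ)) (f := h) hp0 hpq
    (fun x hx => (A.hasDerivAt x (hs hx)).differentiableAt)
    ((hc1.integrableOn_Icc).congr_fun (fun x hx => (hderiv x hx).symm) measurableSet_Icc)
  simp only [mul_one, Finset.sum_const, Nat.card_Icc, nsmul_eq_mul, tsub_zero] at abel
  have hfl : ∀ x : ℝ, 0 ≤ x → ((⌊x⌋₊ + 1 : ℕ) : ℝ) = x + 1 / 2 - sawtooth x := by
    intro x hx
    push_cast
    rw [natCast_floor_eq_intCast_floor hx, floor_eq_sub_sawtooth]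
    ring
  have hI1 : IntervalIntegrable (fun x => h1 x * (x + 1 / 2)) volume p q :=
    hi1.mul_continuousOn (by fun_prop)
  have hI2 : IntervalIntegrable (fun x => sawtooth x * h1 x) volume p q :=
    (intervalIntegrable_sawtooth p q).mul_continuousOn (by rwa [uIcc_of_le hpq])
  have e1 : ∫ x in Ioc p q, deriv h x * ((⌊x⌋₊ + 1 : ℕ) : ℝ) =
      (∫ x in p..q, h1 x * (x + 1 / 2)) - ∫ x in p..q, sawtooth x * h1 x := by
    rw [← intervalIntegral.integral_of_le hpq, ← intervalIntegral.integral_sub hI1 hI2]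
    refine intervalIntegral.integral_congr fun x hx => ?_
    rw [uIcc_of_le hpq] at hx
    rw [hderiv x hx, hfl x (hp0.trans hx.1)]
    ring
  have e2 := intervalIntegral.integral_deriv_mul_eq_sub_of_hasDeriv_right
    (u := h) (v := fun x => x + 1 / 2) (u' := h1) (v' := fun _ => 1) (a := p) (b := q)
    (by rwa [uIcc_of_le hpq]) (by fun_prop)
    (fun x hx => (A.hasDerivAt x (hmem x hx)).hasDerivWithinAt)
    (fun x _ => ((hasDerivAt_id x).add_const (1 / 2 : ℝ)).hasDerivWithinAt) hi1
    intervalIntegrable_const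
  simp only [mul_one] at e2
  rw [intervalIntegral.integral_add hI1 (hc.intervalIntegrable_of_Icc hpq)] at e2
  have e3 := intervalIntegral.integral_deriv_mul_eq_sub_of_hasDeriv_right
    (u := sawtoothPrim) (v := h1) (u' := sawtooth) (v' := h2) (a := p) (b := q)
    continuous_sawtoothPrim.continuousOn (by rwa [uIcc_of_le hpq])
    (fun x _ => hasDerivWithinAt_sawtoothPrim x)
    (fun x hx => (A.hasDerivAt1 x (hmem x hx)).hasDerivWithinAt) (intervalIntegrable_sawtooth p q)
    (A.integral_h2 hp.le hpq hq).1
  have hI3 : IntervalIntegrable (fun x => sawtoothPrim x * h2 x) volume p q :=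
    (A.integral_h2 hp.le hpq hq).1.continuousOn_mul continuous_sawtoothPrim.continuousOn
  rw [intervalIntegral.integral_add hI2 hI3] at e3
  rw [e1, hfl q (hp0.trans hpq), hfl p hp0] at abel
  have e4 : ∑ n ∈ Finset.Ioc ⌊p⌋₊ ⌊q⌋₊, h n - (∫ x in p..q, h x) - sawtooth p * h p +
      sawtooth q * h q = ∫ x in p..q, sawtooth x * h1 x := by
    rw [abel]
    linarith
  have e5 : |∫ x in p..q, sawtoothPrim x * h2 x| ≤ 1 / 8 * (h1 q - h1 p) := by
    rw [← (A.integral_h2 hp.le hpq hq).2, ← intervalIntegral.integral_const_mul,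
      ← Real.norm_eq_abs]
    refine intervalIntegral.norm_integral_le_of_norm_le hpq ?_
      ((A.integral_h2 hp.le hpq hq).1.const_mul _)
    refine Filter.Eventually.of_forall fun x hx => ?_
    have := (A.pos x (hs' ⟨hx.1.le, hx.2⟩)).le
    rw [Real.norm_eq_abs, abs_mul, abs_of_nonneg this]
    exact mul_le_mul_of_nonneg_right (abs_sawtoothPrim_le x) this
  rw [e4]
  have hpm : p ∈ Ico a b := hs' ⟨le_rfl, hpq⟩
  have hqm : q ∈ Ico a b := hs' ⟨hpq, le_rfl⟩
  -- The boundary terms and the integral give `(-h1 q - h1 p + h1 q - h1 p) / 8 = |h1 p| / 4`: the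
  -- slope at `q` cancels, so the bound is uniform as `q → b`.
  have n1 := A.neg p hpm
  have n2 := A.neg q hqm
  have n3 := A.neg a ⟨le_rfl, A.lt⟩
  have n4 := A.h1_mono hpm
  have b1 := mul_le_mul_of_nonneg_right (abs_sawtoothPrim_le q) (abs_nonneg (h1 q))
  have b2 := mul_le_mul_of_nonneg_right (abs_sawtoothPrim_le p) (abs_nonneg (h1 p))
  rw [← abs_mul] at b1 b2
  rw [abs_of_neg n1] at b2
  rw [abs_of_neg n2] at b1
  rw [abs_of_neg n3]
  rw [abs_le] at b1 b2 e5 ⊢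
  constructor <;> linarith [b1.1, b1.2, b2.1, b2.2, e5.1, e5.2]

lemma abs_sum_sub_integral_le_of_lt (A : ArcData h h1 h2 a b m t) {p : ℝ} (hp : a < p)
    (hpb : p < b) :
    |∑ n ∈ Finset.Ioc ⌊p⌋₊ ⌊b⌋₊, h n - (∫ x in p..b, h x) - sawtooth p * h p| ≤
      1 / 4 * |h1 a| := by
  have hp0 : 0 ≤ p := A.nonneg.trans hp.le
  have hc : ContinuousOn h (Icc p b) := A.cont.mono (Icc_subset_Icc_left hp.le)
  have hb : Filter.Tendsto h (nhdsWithin b (Iio b)) (nhds 0) := by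
    have := A.cont b ⟨A.lt.le, le_rfl⟩
    rw [ContinuousWithinAt, A.apply_b] at this
    exact this.mono_left (nhdsWithin_le_of_mem (Icc_mem_nhdsLT_of_mem ⟨A.lt, le_rfl⟩))
  have hsaw : Filter.Tendsto (fun q => sawtooth q * h q) (nhdsWithin b (Iio b)) (nhds 0) := by
    refine squeeze_zero_norm' (a := fun q => 1 / 2 * |h q|) ?_ ?_
    · refine Filter.Eventually.of_forall fun q => ?_
      rw [Real.norm_eq_abs, abs_mul]
      exact mul_le_mul_of_nonneg_right (abs_sawtooth_le q) (abs_nonneg _)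
    · have := hb.abs.const_mul (1 / 2 : ℝ)
      rwa [abs_zero, mul_zero] at this
  have hint : Filter.Tendsto (fun q => ∫ x in p..q, h x) (nhdsWithin b (Iio b))
      (nhds (∫ x in p..b, h x)) := by
    have hco := intervalIntegral.continuousOn_primitive_interval (μ := volume) (f := h) (a := p)
      (b := b) (by rw [uIcc_of_le hpb.le]; exact hc.integrableOn_Icc)
    rw [uIcc_of_le hpb.le] at hco
    exact (hco b ⟨hpb.le, le_rfl⟩).mono_left
      (nhdsWithin_le_of_mem (Icc_mem_nhdsLT_of_mem ⟨hpb, le_rfl⟩))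
  have hlim := (((hint.const_sub (∑ n ∈ Finset.Ioc ⌊p⌋₊ ⌊b⌋₊, h n)).sub_const
    (sawtooth p * h p)).add hsaw).abs
  rw [add_zero] at hlim
  refine le_of_tendsto hlim ?_
  -- For `q` beyond `⌈b⌉ - 1` the only integer possibly in `(q, b]` is `b` itself, where `h`
  -- vanishes.
  have hceil : (⌈b⌉ : ℝ) - 1 < b := by linarith [Int.ceil_lt_add_one b]
  filter_upwards [Ioo_mem_nhdsLT hpb, Ioo_mem_nhdsLT hceil] with q hq hq'
  have hsum : ∑ n ∈ Finset.Ioc ⌊p⌋₊ ⌊b⌋₊, h n = ∑ n ∈ Finset.Ioc ⌊p⌋₊ ⌊q⌋₊, h n := by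
    rw [← Finset.sum_Ioc_consecutive _ (Nat.floor_mono hq.1.le) (Nat.floor_mono hq.2.le),
      add_eq_left]
    refine Finset.sum_eq_zero fun n hn => ?_
    rw [Finset.mem_Ioc] at hn
    have h1 : q < n := Nat.lt_of_floor_lt hn.1
    have h2 : (n : ℝ) ≤ b := (Nat.le_floor_iff' (by omega)).mp hn.2
    have h3 : ⌈b⌉ < (n : ℤ) + 1 := by
      have : (⌈b⌉ : ℝ) < (n : ℝ) + 1 := by linarith [hq'.1]
      exact_mod_cast this
    have h4 : b ≤ n := by
      have : (⌈b⌉ : ℝ) ≤ n := by exact_mod_cast Int.lt_add_one_iff.mp h3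
      exact (Int.le_ceil b).trans this
    rw [le_antisymm h2 h4, A.apply_b]
  rw [hsum]
  exact A.abs_sum_sub_integral_le_aux hp hq.1.le hq.2

/-- Euler–Maclaurin summation over `(a, b]`. -/
lemma abs_sum_sub_integral_le (A : ArcData h h1 h2 a b m t) :
    |∑ n ∈ Finset.Ioc ⌊a⌋₊ ⌊b⌋₊, h n - (∫ x in a..b, h x) - sawtooth a * h a| ≤
      1 / 4 * |h1 a| := by
  have ha : Filter.Tendsto h (nhdsWithin a (Ioi a)) (nhds (h a)) :=
    (A.cont a ⟨le_rfl, A.lt.le⟩).mono_left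
      (nhdsWithin_le_of_mem (Icc_mem_nhdsGT_of_mem ⟨le_rfl, A.lt⟩))
  -- Immediately to the right of `a` the floor is constant, so `sawtooth` is right continuous there.
  have hsaw : Filter.Tendsto (fun p => (p - ⌊a⌋ - 1 / 2) * h p) (nhdsWithin a (Ioi a))
      (nhds (sawtooth a * h a)) := by
    refine Filter.Tendsto.mul ?_ ha
    have : sawtooth a = a - ⌊a⌋ - 1 / 2 := by unfold sawtooth; rw [← Int.self_sub_floor]
    rw [this]
    exact Filter.Tendsto.mono_left (Continuous.tendsto (by fun_prop) a) nhdsWithin_le_nhds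
  have hint : Filter.Tendsto (fun p => ∫ x in p..b, h x) (nhdsWithin a (Ioi a))
      (nhds (∫ x in a..b, h x)) := by
    have hco := intervalIntegral.continuousOn_primitive_interval_left (μ := volume) (f := h)
      (a := a) (b := b) (by rw [uIcc_of_le A.lt.le]; exact A.cont.integrableOn_Icc)
    rw [uIcc_of_le A.lt.le] at hco
    exact (hco a ⟨le_rfl, A.lt.le⟩).mono_left
      (nhdsWithin_le_of_mem (Icc_mem_nhdsGT_of_mem ⟨le_rfl, A.lt⟩))
  have hlim := ((hint.const_sub (∑ n ∈ Finset.Ioc ⌊a⌋₊ ⌊b⌋₊, h n)).sub hsaw).abs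
  refine le_of_tendsto hlim ?_
  filter_upwards [Ioo_mem_nhdsGT A.lt, Ioo_mem_nhdsGT (Int.lt_floor_add_one a)] with p hp hp'
  have hfl : ⌊p⌋ = ⌊a⌋ := by
    rw [Int.floor_eq_iff]
    exact ⟨(Int.floor_le a).trans hp.1.le, hp'.2⟩
  have hfl' : ⌊p⌋₊ = ⌊a⌋₊ := by rw [← Int.floor_toNat, ← Int.floor_toNat, hfl]
  have hsp : p - ⌊a⌋ - 1 / 2 = sawtooth p := by
    unfold sawtooth; rw [← Int.self_sub_floor, hfl]
  rw [hsp, ← hfl']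
  exact A.abs_sum_sub_integral_le_of_lt hp.1 hp.2

/-- The remainder terms contributed by one arc, with tail length `δ`. -/
noncomputable def bound (h1 h2 : ℝ → ℝ) (a b : ℝ) (m : ℕ) (t : ℕ → ℝ) (δ : ℝ) : ℝ :=
  6 * (∫ x in a..b, h2 x ^ (1 / 3 : ℝ)) + 175 * (1 / √(h2 (b - δ))) +
    525 * ∑ i ∈ Finset.range m, 1 / √(h2 (t i)) +
    1 / 4 * ∑ i ∈ Finset.range m, |h1 (t i)| + 1 / 2 * δ + 3 * m

/-- The number of lattice points below an arc, up to `ArcData.bound`. -/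
lemma abs_sum_floor_le (A : ArcData h h1 h2 a b m t) {δ : ℝ} (hδ : 0 < δ) (hδ' : δ < b - a) :
    |∑ n ∈ Finset.Ioc ⌊a⌋₊ ⌊b⌋₊, (⌊h n⌋ : ℝ) - (∫ x in a..b, h x) - sawtooth a * h a +
      ((⌊b⌋₊ : ℝ) - ⌊a⌋₊) / 2| ≤ bound h1 h2 a b m t δ := by
  have haw : a ≤ b - δ := by linarith
  have hwb : b - δ < b := by linarith
  have s1 := A.abs_sum_sawtooth_le haw hwb
  have s2 := A.abs_sum_sub_integral_le
  have hfa : ⌊a⌋₊ ≤ ⌊b⌋₊ := Nat.floor_mono A.lt.le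
  have hfw : ⌊b - δ⌋₊ ≤ ⌊b⌋₊ := Nat.floor_mono hwb.le
  -- The tail holds at most `δ + 1` integers, each costing at most `1/2`.
  have s3 : |∑ n ∈ Finset.Ioc ⌊b - δ⌋₊ ⌊b⌋₊, sawtooth (h n)| ≤ (δ + 1) / 2 := by
    refine (_root_.abs_sum_sawtooth_le _ _).trans ?_
    have h1 := Nat.floor_le (A.nonneg.trans A.lt.le)
    have h2 := Nat.lt_floor_add_one (b - δ)
    rw [Nat.card_Ioc, Nat.cast_sub hfw]
    linarith
  have hsplit := Finset.sum_Ioc_consecutive (fun n : ℕ => sawtooth (h n)) (Nat.floor_mono haw) hfw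
  have e1 : ∑ n ∈ Finset.Ioc ⌊a⌋₊ ⌊b⌋₊, (⌊h n⌋ : ℝ) = ∑ n ∈ Finset.Ioc ⌊a⌋₊ ⌊b⌋₊, h n -
      ((⌊b⌋₊ : ℝ) - ⌊a⌋₊) / 2 - ∑ n ∈ Finset.Ioc ⌊a⌋₊ ⌊b⌋₊, sawtooth (h n) := by
    simp only [floor_eq_sub_sawtooth]
    rw [Finset.sum_sub_distrib, Finset.sum_sub_distrib, Finset.sum_const, Nat.card_Ioc,
      nsmul_eq_mul, Nat.cast_sub hfa]
    ring
  have hint : ∫ x in a..b - δ, h2 x ^ (1 / 3 : ℝ) ≤ ∫ x in a..b, h2 x ^ (1 / 3 : ℝ) := by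
    refine intervalIntegral.integral_mono_interval le_rfl haw hwb.le ?_ A.intervalIntegrable_rpow
    -- The sign of `h2` is unknown at `b`, a null set.
    have hae : ∀ᵐ x : ℝ, x ≠ b := by simp [ae_iff]
    refine (ae_restrict_iff' measurableSet_Ioc).mpr ?_
    filter_upwards [hae] with x hxb hx
    exact Real.rpow_nonneg (A.pos x ⟨hx.1.le, lt_of_le_of_ne hx.2 hxb⟩).le _
  have hh1 : |h1 a| ≤ ∑ i ∈ Finset.range m, |h1 (t i)| := by
    rw [← A.first]
    exact Finset.single_le_sum (f := fun i => |h1 (t i)|) (fun i _ => abs_nonneg _)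
      (Finset.mem_range.mpr A.m_pos)
  have hS : 0 ≤ ∑ i ∈ Finset.range m, 1 / √(h2 (t i)) :=
    Finset.sum_nonneg fun i _ => by positivity
  have hm : (1 : ℝ) ≤ m := by exact_mod_cast A.m_pos
  have hw : 0 ≤ 1 / √(h2 (b - δ)) := by positivity
  have e28 : 28 / √(h2 (b - δ)) = 28 * (1 / √(h2 (b - δ))) := by ring
  rw [e28] at s1
  unfold bound
  rw [abs_le] at s1 s2 s3 ⊢
  rw [e1, ← hsplit]
  constructor <;> linarith [s1.1, s1.2, s2.1, s2.2, s3.1, s3.2]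

end ArcData

/-! ### The inverse function, the area and the lattice count. -/

namespace ConvexCurve

variable (Γ : ConvexCurve)

lemma image_f : Γ.f '' Icc 0 Γ.L = Icc 0 Γ.M := by
  apply Subset.antisymm
  · rintro _ ⟨x, hx, rfl⟩
    have h0 : (0 : ℝ) ∈ Icc 0 Γ.L := ⟨le_rfl, Γ.L_pos.le⟩
    have hL : Γ.L ∈ Icc 0 Γ.L := ⟨Γ.L_pos.le, le_rfl⟩
    constructor
    · rw [← Γ.f_L]; exact Γ.strictAntiOn_f.antitoneOn hx hL hx.2
    · rw [← Γ.f_zero]; exact Γ.strictAntiOn_f.antitoneOn h0 hx hx.1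
  · have := intermediate_value_Icc' Γ.L_pos.le Γ.continuousOn_f
    rwa [Γ.f_zero, Γ.f_L] at this

lemma f_mem {x : ℝ} (hx : x ∈ Icc 0 Γ.L) : Γ.f x ∈ Icc 0 Γ.M := by
  rw [← Γ.image_f]; exact mem_image_of_mem _ hx

lemma g_mem {y : ℝ} (hy : y ∈ Icc 0 Γ.M) : Γ.g y ∈ Icc 0 Γ.L :=
  Function.invFunOn_mem (by rw [← Γ.image_f] at hy; exact hy)

lemma f_g {y : ℝ} (hy : y ∈ Icc 0 Γ.M) : Γ.f (Γ.g y) = y :=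
  Function.invFunOn_eq (by rw [← Γ.image_f] at hy; exact hy)

lemma g_f {x : ℝ} (hx : x ∈ Icc 0 Γ.L) : Γ.g (Γ.f x) = x :=
  Γ.strictAntiOn_f.injOn (Γ.g_mem (Γ.f_mem hx)) hx (Γ.f_g (Γ.f_mem hx))

lemma le_f_iff {x y : ℝ} (hx : x ∈ Icc 0 Γ.L) (hy : y ∈ Icc 0 Γ.M) : y ≤ Γ.f x ↔ x ≤ Γ.g y := by
  rw [← Γ.strictAntiOn_f.le_iff_ge (Γ.g_mem hy) hx, Γ.f_g hy]

lemma lt_f_iff {x y : ℝ} (hx : x ∈ Icc 0 Γ.L) (hy : y ∈ Icc 0 Γ.M) : y < Γ.f x ↔ x < Γ.g y := by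
  rw [← Γ.strictAntiOn_f.lt_iff_gt (Γ.g_mem hy) hx, Γ.f_g hy]

lemma g_M : Γ.g Γ.M = 0 := by
  rw [← Γ.f_zero]; exact Γ.g_f ⟨le_rfl, Γ.L_pos.le⟩

/-- The preimage of a closed set under `g` is the image under `f` of a compact set. -/
lemma continuousOn_g : ContinuousOn Γ.g (Icc 0 Γ.M) := by
  rw [continuousOn_iff_isClosed]
  intro t ht
  refine ⟨Γ.f '' (Icc 0 Γ.L ∩ t), ((isCompact_Icc.inter_right ht).image_of_continuousOn
    (Γ.continuousOn_f.mono inter_subset_left)).isClosed, ?_⟩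
  ext y
  constructor
  · rintro ⟨h1, h2⟩
    exact ⟨⟨Γ.g y, ⟨Γ.g_mem h2, h1⟩, Γ.f_g h2⟩, h2⟩
  · rintro ⟨⟨x, ⟨hx, hxt⟩, rfl⟩, h2⟩
    refine ⟨?_, h2⟩
    rw [mem_preimage, Γ.g_f hx]
    exact hxt

variable {Γ} {α β : ℝ}

lemma mem_of_graph (hαβ : (α, β) ∈ Γ.graph) (hβ : 0 < β) :
    α ∈ Icc 0 Γ.L ∧ β = Γ.f α ∧ α < Γ.L := by
  obtain ⟨h1, h2⟩ := hαβ
  refine ⟨h1, h2, lt_of_le_of_ne h1.2 ?_⟩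
  rintro rfl
  simp only [Γ.f_L] at h2
  linarith

lemma mem_Icc_of_graph (hαβ : (α, β) ∈ Γ.graph) (hα : 0 < α) :
    β ∈ Icc 0 Γ.M ∧ Γ.g β = α ∧ β < Γ.M := by
  obtain ⟨h1, h2⟩ := hαβ
  simp only at h1 h2
  refine ⟨?_, ?_, ?_⟩
  · rw [h2]; exact Γ.f_mem h1
  · rw [h2]; exact Γ.g_f h1
  · rw [h2, ← Γ.f_zero]; exact Γ.strictAntiOn_f ⟨le_rfl, Γ.L_pos.le⟩ h1 hα

variable (Γ) in
lemma area_eq_integral : Γ.area = ∫ x in 0..Γ.L, Γ.f x := by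
  have hi : IntegrableOn Γ.f (Ioo 0 Γ.L) :=
    (Γ.continuousOn_f.integrableOn_Icc).mono_set Ioo_subset_Icc_self
  have h := volume_regionBetween_eq_integral (μ := volume) (f := fun _ => (0 : ℝ))
    integrableOn_zero hi measurableSet_Ioo
    (fun x hx => (Γ.f_mem (Ioo_subset_Icc_self hx)).1)
  have e : ∫ y in Ioo 0 Γ.L, (Γ.f - fun _ : ℝ => (0 : ℝ)) y = ∫ x in 0..Γ.L, Γ.f x := by
    rw [intervalIntegral.integral_of_le Γ.L_pos.le, integral_Ioc_eq_integral_Ioo]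
    simp
  rw [e] at h
  unfold area Measure.real
  have h' : volume {p : ℝ × ℝ | p.1 ∈ Ioo 0 Γ.L ∧ p.2 ∈ Ioo 0 (Γ.f p.1)} =
    ENNReal.ofReal (∫ x in 0..Γ.L, Γ.f x) := h
  rw [h', ENNReal.toReal_ofReal]
  exact intervalIntegral.integral_nonneg Γ.L_pos.le fun x hx => (Γ.f_mem hx).1

/-- Reflection in the diagonal carries the region under `g` over `(β, M)` to the part of the region
under `f` above height `β`. -/
lemma integral_f_eq (hαβ : (α, β) ∈ Γ.graph) (hα : 0 < α) :
    ∫ x in 0..α, Γ.f x = α * β + ∫ y in β..Γ.M, Γ.g y := by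
  obtain ⟨hβm, hgβ, hβM⟩ := mem_Icc_of_graph hαβ hα
  obtain ⟨hαm, hfα⟩ := hαβ
  simp only at hαm hfα
  have hsub : Ioo 0 α ⊆ Icc 0 Γ.L := fun x hx => ⟨hx.1.le, hx.2.le.trans hαm.2⟩
  have hsub' : Ioo β Γ.M ⊆ Icc 0 Γ.M := fun y hy => ⟨hβm.1.trans hy.1.le, hy.2.le⟩
  have hi : IntegrableOn Γ.f (Ioo 0 α) := Γ.continuousOn_f.integrableOn_Icc.mono_set hsub
  have hi' : IntegrableOn Γ.g (Ioo β Γ.M) := Γ.continuousOn_g.integrableOn_Icc.mono_set hsub'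
  have h1 := volume_regionBetween_eq_integral (μ := volume) (f := fun _ => β)
    (integrableOn_const (by simp)) hi measurableSet_Ioo
    (fun x hx => by
      rw [hfα]
      exact Γ.strictAntiOn_f.antitoneOn (hsub hx) hαm hx.2.le)
  have h2 := volume_regionBetween_eq_integral (μ := volume) (f := fun _ => (0 : ℝ))
    integrableOn_zero hi' measurableSet_Ioo (fun y hy => (Γ.g_mem (hsub' hy)).1)
  have hswap : Prod.swap ⁻¹' regionBetween (fun _ => (0 : ℝ)) Γ.g (Ioo β Γ.M) =
      regionBetween (fun _ => β) Γ.f (Ioo 0 α) := by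
    ext ⟨x, y⟩
    simp only [regionBetween, mem_preimage, Prod.swap_prod_mk, mem_ofPred_eq]
    constructor
    · rintro ⟨hy, hx0, hx⟩
      have hxL : x ∈ Icc 0 Γ.L := ⟨hx0.le, hx.le.trans (Γ.g_mem (hsub' hy)).2⟩
      have hyf := (Γ.lt_f_iff hxL (hsub' hy)).mpr hx
      refine ⟨⟨hx0, ?_⟩, hy.1, hyf⟩
      by_contra hc
      have := Γ.strictAntiOn_f.antitoneOn hαm hxL (not_lt.mp hc)
      linarith [hy.1]
    · rintro ⟨hx, hy1, hy2⟩
      have hxL := hsub hx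
      have hyM : y < Γ.M := by
        have := Γ.strictAntiOn_f ⟨le_rfl, Γ.L_pos.le⟩ hxL hx.1
        rw [Γ.f_zero] at this
        linarith
      have hy : y ∈ Icc 0 Γ.M := hsub' ⟨hy1, hyM⟩
      exact ⟨⟨hy1, hyM⟩, hx.1, (Γ.lt_f_iff hxL hy).mp hy2⟩
  have hmp := (Measure.measurePreserving_swap (μ := (volume : Measure ℝ))
    (ν := (volume : Measure ℝ))).measure_preimage_emb
    MeasurableEquiv.prodComm.measurableEmbedding
    (regionBetween (fun _ => (0 : ℝ)) Γ.g (Ioo β Γ.M))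
  rw [hswap, h1, h2] at hmp
  have n1 : 0 ≤ ∫ y in Ioo 0 α, (Γ.f - fun _ : ℝ => β) y :=
    setIntegral_nonneg measurableSet_Ioo fun x hx => by
      have := Γ.strictAntiOn_f.antitoneOn (hsub hx) hαm hx.2.le
      simp only [Pi.sub_apply]
      linarith
  have n2 : 0 ≤ ∫ y in Ioo β Γ.M, (Γ.g - fun _ : ℝ => (0 : ℝ)) y :=
    setIntegral_nonneg measurableSet_Ioo fun y hy => by
      have := (Γ.g_mem (hsub' hy)).1
      simpa using this
  have heq := (ENNReal.ofReal_eq_ofReal_iff n1 n2).mp hmp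
  simp only [Pi.sub_apply, sub_zero] at heq
  rw [integral_sub hi (integrableOn_const (by simp))] at heq
  rw [intervalIntegral.integral_of_le hα.le, integral_Ioc_eq_integral_Ioo,
    intervalIntegral.integral_of_le hβM.le, integral_Ioc_eq_integral_Ioo, ← heq]
  simp [hα.le]

lemma area_eq (hαβ : (α, β) ∈ Γ.graph) (hα : 0 < α) :
    Γ.area = α * β + (∫ x in α..Γ.L, Γ.f x) + ∫ y in β..Γ.M, Γ.g y := by
  obtain ⟨hαm, -⟩ := id hαβ
  simp only at hαm
  rw [area_eq_integral, ← intervalIntegral.integral_add_adjacent_intervals (b := α),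
    integral_f_eq hαβ hα]
  · ring
  · exact (Γ.continuousOn_f.mono (Icc_subset_Icc_right hαm.2)).intervalIntegrable_of_Icc hα.le
  · exact (Γ.continuousOn_f.mono (Icc_subset_Icc_left hα.le)).intervalIntegrable_of_Icc hαm.2

lemma card_filter_product {s t : Finset ℕ} (P : ℕ → ℕ → Prop) [∀ j k, Decidable (P j k)] :
    ((s ×ˢ t).filter fun p => P p.1 p.2).card = ∑ j ∈ s, (t.filter fun k => P j k).card := by
  simp only [Finset.card_filter]
  rw [Finset.sum_product]

lemma card_filter_product_right {s t : Finset ℕ} (P : ℕ → ℕ → Prop) [∀ j k, Decidable (P j k)] :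
    ((s ×ˢ t).filter fun p => P p.1 p.2).card = ∑ k ∈ t, (s.filter fun j => P j k).card := by
  simp only [Finset.card_filter]
  rw [Finset.sum_product_right]

-- The rectangle lies under the curve by monotonicity, and no counted point has both `j > α` and `k
-- > β`, since `f j < β` beyond `α`. So the three pieces are disjoint.
open Classical in
lemma latticeCount_eq (hαβ : (α, β) ∈ Γ.graph) (hα : 0 < α) (hβ : 0 < β) :
    latticeCount Γ.f Γ.L = ⌊α⌋₊ * ⌊β⌋₊ + ∑ j ∈ Finset.Ioc ⌊α⌋₊ ⌊Γ.L⌋₊, ⌊Γ.f j⌋₊ +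
      ∑ k ∈ Finset.Ioc ⌊β⌋₊ ⌊Γ.M⌋₊, ⌊Γ.g k⌋₊ := by
  obtain ⟨hβm, hgβ, hβM⟩ := mem_Icc_of_graph hαβ hα
  obtain ⟨hαm, hfα, hαL⟩ := mem_of_graph hαβ hβ
  have hL := Γ.L_pos
  have hM := Γ.M_pos
  set T1 := Finset.Ioc 0 ⌊α⌋₊ ×ˢ Finset.Ioc 0 ⌊β⌋₊ with hT1
  set T2 := (Finset.Ioc ⌊α⌋₊ ⌊Γ.L⌋₊ ×ˢ Finset.Ioc 0 ⌊Γ.M⌋₊).filter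
    (fun p : ℕ × ℕ => (p.2 : ℝ) ≤ Γ.f p.1) with hT2
  set T3 := (Finset.Ioc 0 ⌊Γ.L⌋₊ ×ˢ Finset.Ioc ⌊β⌋₊ ⌊Γ.M⌋₊).filter
    (fun p : ℕ × ℕ => (p.2 : ℝ) ≤ Γ.f p.1) with hT3
  have hbelow : ∀ x ∈ Icc 0 Γ.L, α < x → Γ.f x < β := fun x hx h => by
    rw [hfα]; exact Γ.strictAntiOn_f hαm hx h
  have hset : {p : ℕ × ℕ | 0 < p.1 ∧ 0 < p.2 ∧ (p.1 : ℝ) ≤ Γ.L ∧ (p.2 : ℝ) ≤ Γ.f p.1} =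
      ((T1 ∪ T2 ∪ T3 : Finset (ℕ × ℕ)) : Set (ℕ × ℕ)) := by
    ext ⟨j, k⟩
    simp only [mem_ofPred_eq, Finset.coe_union, mem_union, Finset.mem_coe, hT1, hT2, hT3,
      Finset.mem_filter, Finset.mem_product, Finset.mem_Ioc, Nat.floor_lt hα.le, Nat.floor_lt hβ.le,
      Nat.le_floor_iff hα.le, Nat.le_floor_iff hβ.le, Nat.le_floor_iff hL.le, Nat.le_floor_iff hM.le]
    constructor
    · rintro ⟨hj, hk, hjL, hkf⟩
      have hjm : (j : ℝ) ∈ Icc 0 Γ.L := ⟨j.cast_nonneg, hjL⟩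
      have hkM : (k : ℝ) ≤ Γ.M := hkf.trans (Γ.f_mem hjm).2
      rcases lt_or_ge α j with h1 | h1
      · exact Or.inl (Or.inr ⟨⟨⟨h1, hjL⟩, hk, hkM⟩, hkf⟩)
      · rcases lt_or_ge β k with h2 | h2
        · exact Or.inr ⟨⟨⟨hj, hjL⟩, h2, hkM⟩, hkf⟩
        · exact Or.inl (Or.inl ⟨⟨hj, h1⟩, hk, h2⟩)
    · rintro ((⟨⟨hj, h1⟩, hk, h2⟩ | ⟨⟨⟨h1, hjL⟩, hk, hkM⟩, hkf⟩) | ⟨⟨⟨hj, hjL⟩, h2, hkM⟩, hkf⟩)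
      · refine ⟨hj, hk, h1.trans hαm.2, h2.trans ?_⟩
        rw [hfα]
        exact Γ.strictAntiOn_f.antitoneOn ⟨j.cast_nonneg, h1.trans hαm.2⟩ hαm h1
      · refine ⟨?_, hk, hjL, hkf⟩
        have : (0 : ℝ) < j := hα.trans h1
        exact_mod_cast this
      · refine ⟨hj, ?_, hjL, hkf⟩
        have : (0 : ℝ) < k := hβ.trans h2
        exact_mod_cast this
  have hd12 : Disjoint T1 T2 := by
    rw [Finset.disjoint_left]
    rintro ⟨j, k⟩ h1 h2
    simp only [hT1, hT2, Finset.mem_filter, Finset.mem_product, Finset.mem_Ioc] at h1 h2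
    omega
  have hd3 : Disjoint (T1 ∪ T2) T3 := by
    rw [Finset.disjoint_left]
    rintro ⟨j, k⟩ h1 h3
    simp only [hT1, hT2, hT3, Finset.mem_union, Finset.mem_filter, Finset.mem_product,
      Finset.mem_Ioc] at h1 h3
    rcases h1 with h1 | h1
    · omega
    · have hj : α < j := (Nat.floor_lt hα.le).mp h1.1.1.1
      have hk : β < k := (Nat.floor_lt hβ.le).mp h3.1.2.1
      have hjL : (j : ℝ) ≤ Γ.L := (Nat.le_floor_iff hL.le).mp h1.1.1.2
      have := hbelow j ⟨j.cast_nonneg, hjL⟩ hj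
      linarith [h1.2]
  unfold latticeCount
  rw [hset, Set.ncard_coe_finset, Finset.card_union_of_disjoint hd3,
    Finset.card_union_of_disjoint hd12]
  congr 1
  · congr 1
    · rw [hT1, Finset.card_product]
      simp
    · rw [hT2, card_filter_product (fun j k : ℕ => (k : ℝ) ≤ Γ.f j)]
      refine Finset.sum_congr rfl fun j hj => ?_
      rw [Finset.mem_Ioc] at hj
      have hjL : (j : ℝ) ≤ Γ.L := (Nat.le_floor_iff hL.le).mp hj.2
      have hf := Γ.f_mem ⟨j.cast_nonneg, hjL⟩
      have : (Finset.Ioc 0 ⌊Γ.M⌋₊).filter (fun k : ℕ => (k : ℝ) ≤ Γ.f j) =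
          Finset.Ioc 0 ⌊Γ.f j⌋₊ := by
        ext k
        simp only [Finset.mem_filter, Finset.mem_Ioc, Nat.le_floor_iff hM.le,
          Nat.le_floor_iff hf.1]
        exact ⟨fun h => ⟨h.1.1, h.2⟩, fun h => ⟨⟨h.1, h.2.trans hf.2⟩, h.2⟩⟩
      rw [this]
      simp
  · rw [hT3, card_filter_product_right (fun j k : ℕ => (k : ℝ) ≤ Γ.f j)]
    refine Finset.sum_congr rfl fun k hk => ?_
    rw [Finset.mem_Ioc] at hk
    have hkM : (k : ℝ) ≤ Γ.M := (Nat.le_floor_iff hM.le).mp hk.2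
    have hg := Γ.g_mem ⟨k.cast_nonneg, hkM⟩
    have : (Finset.Ioc 0 ⌊Γ.L⌋₊).filter (fun j : ℕ => (k : ℝ) ≤ Γ.f j) =
        Finset.Ioc 0 ⌊Γ.g k⌋₊ := by
      ext j
      simp only [Finset.mem_filter, Finset.mem_Ioc, Nat.le_floor_iff hL.le,
        Nat.le_floor_iff hg.1]
      constructor
      · rintro ⟨⟨h1, h2⟩, h3⟩
        exact ⟨h1, (Γ.le_f_iff ⟨j.cast_nonneg, h2⟩ ⟨k.cast_nonneg, hkM⟩).mp h3⟩
      · rintro ⟨h1, h2⟩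
        have h3 := h2.trans hg.2
        exact ⟨⟨h1, h3⟩, (Γ.le_f_iff ⟨j.cast_nonneg, h3⟩ ⟨k.cast_nonneg, hkM⟩).mpr h2⟩
    rw [this]
    simp

/-- The lattice point count of a curve split into two arcs. -/
theorem abs_latticeCount_sub_le (hαβ : (α, β) ∈ Γ.graph) (hα : 0 < α) (hβ : 0 < β)
    {f1 f2 g1 g2 : ℝ → ℝ} {m n : ℕ} {a b : ℕ → ℝ} (A : ArcData Γ.f f1 f2 α Γ.L m a)
    (B : ArcData Γ.g g1 g2 β Γ.M n b) {δ ε : ℝ} (hδ : 0 < δ) (hδ' : δ < Γ.L - α) (hε : 0 < ε)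
    (hε' : ε < Γ.M - β) :
    |(latticeCount Γ.f Γ.L : ℝ) - Γ.area + (Γ.L + Γ.M) / 2| ≤
      ArcData.bound f1 f2 α Γ.L m a δ + ArcData.bound g1 g2 β Γ.M n b ε + 1 := by
  have hA := A.abs_sum_floor_le hδ hδ'
  have hB := B.abs_sum_floor_le hε hε'
  obtain ⟨hβm, hgβ, hβM⟩ := mem_Icc_of_graph hαβ hα
  obtain ⟨hαm, hfα, hαL⟩ := mem_of_graph hαβ hβ
  have hfl : ∀ x : ℝ, 0 ≤ x → (⌊x⌋₊ : ℝ) = x - 1 / 2 - sawtooth x := fun x hx => by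
    rw [natCast_floor_eq_intCast_floor hx, floor_eq_sub_sawtooth]
  have eA : ((∑ j ∈ Finset.Ioc ⌊α⌋₊ ⌊Γ.L⌋₊, ⌊Γ.f j⌋₊ : ℕ) : ℝ) =
      ∑ j ∈ Finset.Ioc ⌊α⌋₊ ⌊Γ.L⌋₊, (⌊Γ.f j⌋ : ℝ) := by
    rw [Nat.cast_sum]
    refine Finset.sum_congr rfl fun j hj => natCast_floor_eq_intCast_floor ?_
    rw [Finset.mem_Ioc] at hj
    exact (Γ.f_mem ⟨j.cast_nonneg, (Nat.le_floor_iff Γ.L_pos.le).mp hj.2⟩).1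
  have eB : ((∑ k ∈ Finset.Ioc ⌊β⌋₊ ⌊Γ.M⌋₊, ⌊Γ.g k⌋₊ : ℕ) : ℝ) =
      ∑ k ∈ Finset.Ioc ⌊β⌋₊ ⌊Γ.M⌋₊, (⌊Γ.g k⌋ : ℝ) := by
    rw [Nat.cast_sum]
    refine Finset.sum_congr rfl fun k hk => natCast_floor_eq_intCast_floor ?_
    rw [Finset.mem_Ioc] at hk
    exact (Γ.g_mem ⟨k.cast_nonneg, (Nat.le_floor_iff Γ.M_pos.le).mp hk.2⟩).1
  rw [latticeCount_eq hαβ hα hβ, area_eq hαβ hα, Nat.cast_add, Nat.cast_add, eA, eB, Nat.cast_mul,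
    hfl α hα.le, hfl β hβ.le]
  rw [hfl α hα.le, hfl Γ.L Γ.L_pos.le, ← hfα] at hA
  rw [hfl β hβ.le, hfl Γ.M Γ.M_pos.le, hgβ] at hB
  have sa := abs_sawtooth_le α
  have sb := abs_sawtooth_le β
  have sL := abs_le.mp (abs_sawtooth_le Γ.L)
  have sM := abs_le.mp (abs_sawtooth_le Γ.M)
  -- After cancellation of the terms `ψ(α) β` and `ψ(β) α`, what is left is `ψ(α) ψ(β) + 1/4 + (ψ(L)
  -- + ψ(M)) / 2`, at most 1 in absolute value.
  have sab : |sawtooth α * sawtooth β| ≤ 1 / 4 := by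
    rw [abs_mul]
    have := mul_le_mul sa sb (abs_nonneg _) (by norm_num)
    linarith
  rw [abs_le] at hA hB sab ⊢
  constructor <;> nlinarith [hA.1, hA.2, hB.1, hB.2, sab.1, sab.2, sL.1, sL.2, sM.1, sM.2]

end ConvexCurve

/-! ### Arcs from the smoothness hypotheses, and their scaling. -/

lemma IsPiecewiseMonotoneC2.arcData {h : ℝ → ℝ} {a b : ℝ} {m : ℕ} {t : ℕ → ℝ}
    (H : IsPiecewiseMonotoneC2 h a b m t) (ha : 0 ≤ a) (hab : a < b) (hb : h b = 0)
    (hc : ContinuousOn h (Icc a b)) :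
    ArcData h (derivIco h a b) (deriv2Ico h a b) a b m t := by
  have hu : UniqueDiffOn ℝ (Ico a b) := uniqueDiffOn_Ico a b
  have h1 := (contDiffOn_succ_iff_derivWithin (n := 1) hu).mp
    (by have := H.contDiffOn; rwa [← one_add_one_eq_two] at this)
  have h2 := (contDiffOn_succ_iff_derivWithin (n := 0) hu).mp
    (by have := h1.2.2; rwa [← zero_add (1 : WithTop ℕ∞)] at this)
  exact
  { nonneg := ha
    lt := hab
    apply_b := hb
    cont := hc
    cont1 := h1.2.2.continuousOn
    cont2 := h2.2.2.continuousOn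
    hasDerivAt := fun x hx => ((h1.1 x (Ioo_subset_Ico_self hx)).hasDerivWithinAt).hasDerivAt
      (Ico_mem_nhds hx.1 hx.2)
    hasDerivAt1 := fun x hx => ((h2.1 x (Ioo_subset_Ico_self hx)).hasDerivWithinAt).hasDerivAt
      (Ico_mem_nhds hx.1 hx.2)
    neg := H.deriv_neg
    pos := H.deriv2_pos
    first := H.first
    last := H.last
    lt_succ := H.lt_succ
    monotonic := H.monotonic }

namespace ArcData

variable {h h1 h2 : ℝ → ℝ} {a b : ℝ} {m : ℕ} {t : ℕ → ℝ}

lemma congr (A : ArcData h h1 h2 a b m t) {k : ℝ → ℝ} (hk : EqOn k h (Icc a b)) :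
    ArcData k h1 h2 a b m t :=
  { A with
    apply_b := by rw [hk ⟨A.lt.le, le_rfl⟩, A.apply_b]
    cont := A.cont.congr hk
    hasDerivAt := fun x hx => (A.hasDerivAt x hx).congr_of_eventuallyEq
      (Filter.eventuallyEq_of_mem (Icc_mem_nhds hx.1 hx.2) hk) }

/-- Stretching an arc by `d` horizontally and by `c` vertically. -/
lemma scale (A : ArcData h h1 h2 a b m t) {c d : ℝ} (hc : 0 < c) (hd : 0 < d) :
    ArcData (fun x => c * h (x / d)) (fun x => c / d * h1 (x / d))
      (fun x => c / d ^ 2 * h2 (x / d)) (d * a) (d * b) m (fun i => d * t i) := by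
  have hdiv : ∀ x, d * x / d = x := fun x => by field_simp
  have hmIco : ∀ x ∈ Ico (d * a) (d * b), x / d ∈ Ico a b := fun x hx =>
    ⟨by rw [le_div_iff₀ hd, mul_comm]; exact hx.1, by rw [div_lt_iff₀ hd, mul_comm]; exact hx.2⟩
  have hmIoo : ∀ u v : ℝ, ∀ x ∈ Ioo (d * u) (d * v), x / d ∈ Ioo u v := fun u v x hx =>
    ⟨by rw [lt_div_iff₀ hd, mul_comm]; exact hx.1, by rw [div_lt_iff₀ hd, mul_comm]; exact hx.2⟩
  have hmIcc : ∀ x ∈ Icc (d * a) (d * b), x / d ∈ Icc a b := fun x hx =>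
    ⟨by rw [le_div_iff₀ hd, mul_comm]; exact hx.1, by rw [div_le_iff₀ hd, mul_comm]; exact hx.2⟩
  have hdd : ∀ x : ℝ, HasDerivAt (fun y : ℝ => y / d) (1 / d) x := fun x =>
    (hasDerivAt_id x).div_const d
  have hcd : 0 < c / d := by positivity
  have hcd2 : 0 < c / d ^ 2 := by positivity
  exact
  { nonneg := mul_nonneg hd.le A.nonneg
    lt := mul_lt_mul_of_pos_left A.lt hd
    apply_b := by simp only [hdiv, A.apply_b, mul_zero]
    cont := continuousOn_const.mul (A.cont.comp (by fun_prop) hmIcc)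
    cont1 := continuousOn_const.mul (A.cont1.comp (by fun_prop) hmIco)
    cont2 := continuousOn_const.mul (A.cont2.comp (by fun_prop) hmIco)
    hasDerivAt := fun x hx => (((A.hasDerivAt _ (hmIoo _ _ x hx)).comp x (hdd x)).const_mul
      c).congr_deriv (by ring)
    hasDerivAt1 := fun x hx => (((A.hasDerivAt1 _ (hmIoo _ _ x hx)).comp x (hdd x)).const_mul
      (c / d)).congr_deriv (by field_simp)
    neg := fun x hx => mul_neg_of_pos_of_neg hcd (A.neg _ (hmIco x hx))
    pos := fun x hx => mul_pos hcd2 (A.pos _ (hmIco x hx))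
    first := by rw [A.first]
    last := by rw [A.last]
    lt_succ := fun i hi => mul_lt_mul_of_pos_left (A.lt_succ i hi) hd
    monotonic := fun i hi => (A.monotonic i hi).imp
      (fun hm x hx y hy hxy => mul_le_mul_of_nonneg_left
        (hm (hmIoo _ _ x hx) (hmIoo _ _ y hy) (by gcongr)) hcd2.le)
      (fun hm x hx y hy hxy => mul_le_mul_of_nonneg_left
        (hm (hmIoo _ _ x hx) (hmIoo _ _ y hy) (by gcongr)) hcd2.le) }

/-- The second derivative scales by `c / d²`, so the cube-root integral scales by `d (c / d²)^(1/3)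
= (c d)^(1/3)`. This depends only on the area factor, so for `c d = r²` no power of `s` appears. -/
lemma bound_scale (A : ArcData h h1 h2 a b m t) {c d : ℝ} (hc : 0 < c) (hd : 0 < d) (δ : ℝ) :
    bound (fun x => c / d * h1 (x / d)) (fun x => c / d ^ 2 * h2 (x / d)) (d * a) (d * b) m
      (fun i => d * t i) (d * δ) =
    6 * ((c * d) ^ (1 / 3 : ℝ) * ∫ x in a..b, h2 x ^ (1 / 3 : ℝ)) +
    175 * (d / √c * (1 / √(h2 (b - δ)))) +
    525 * (d / √c * ∑ i ∈ Finset.range m, 1 / √(h2 (t i))) +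
    1 / 4 * (c / d * ∑ i ∈ Finset.range m, |h1 (t i)|) + 1 / 2 * (d * δ) + 3 * m := by
  have hdiv : ∀ x, d * x / d = x := fun x => by field_simp
  have hcd2 : 0 < c / d ^ 2 := by positivity
  have hsq : ∀ y, 1 / √(c / d ^ 2 * y) = d / √c * (1 / √y) := fun y => by
    rw [Real.sqrt_mul hcd2.le, Real.sqrt_div hc.le, Real.sqrt_sq hd.le]
    rw [one_div, mul_inv, inv_div, one_div]
  have hint : ∫ x in d * a..d * b, (c / d ^ 2 * h2 (x / d)) ^ (1 / 3 : ℝ) =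
      (c * d) ^ (1 / 3 : ℝ) * ∫ x in a..b, h2 x ^ (1 / 3 : ℝ) := by
    have h := intervalIntegral.integral_comp_div (a := d * a) (b := d * b)
      (fun x => (c / d ^ 2 * h2 x) ^ (1 / 3 : ℝ)) hd.ne'
    rw [hdiv, hdiv] at h
    rw [h, smul_eq_mul, ← intervalIntegral.integral_const_mul,
      ← intervalIntegral.integral_const_mul]
    have hpow : d * (c / d ^ 2) ^ (1 / 3 : ℝ) = (c * d) ^ (1 / 3 : ℝ) := by
      have hd3 : d = (d ^ 3) ^ (1 / 3 : ℝ) := by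
        rw [← Real.rpow_natCast, ← Real.rpow_mul hd.le]; norm_num
      nth_rewrite 1 [hd3]
      rw [← Real.mul_rpow (by positivity) (by positivity)]
      congr 1
      field_simp
    have hae : ∀ᵐ x : ℝ, x ≠ b := by simp [ae_iff]
    refine intervalIntegral.integral_congr_ae ?_
    filter_upwards [hae] with x hxb hx
    rw [uIoc_of_le A.lt.le] at hx
    have hp := A.pos x ⟨hx.1.le, lt_of_le_of_ne hx.2 hxb⟩
    rw [Real.mul_rpow hcd2.le hp.le, ← mul_assoc, hpow]
  unfold bound
  rw [hint, ← mul_sub]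
  simp only [hdiv, hsq, abs_mul, abs_of_pos (div_pos hc hd), Finset.mul_sum]

end ArcData

namespace ConvexCurve

/-- The stretched curve `r Γ(s)`. -/
noncomputable def scale (Γ : ConvexCurve) (r s : ℝ) (hr : 0 < r) (hs : 0 < s) : ConvexCurve where
  L := r * s⁻¹ * Γ.L
  M := r * s * Γ.M
  f := fun x => r * s * Γ.f (s * x / r)
  L_pos := by have := Γ.L_pos; positivity
  M_pos := by have := Γ.M_pos; positivity
  f_zero := by simp [Γ.f_zero]
  f_L := by
    have : s * (r * s⁻¹ * Γ.L) / r = Γ.L := by field_simp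
    rw [this, Γ.f_L, mul_zero]
  continuousOn_f := by
    refine continuousOn_const.mul (Γ.continuousOn_f.comp (by fun_prop) fun x hx => ⟨?_, ?_⟩)
    · have := hx.1; positivity
    · rw [div_le_iff₀ hr]
      have := mul_le_mul_of_nonneg_left hx.2 hs.le
      have e : s * (r * s⁻¹ * Γ.L) = Γ.L * r := by field_simp
      linarith
  strictAntiOn_f := by
    have hm : ∀ x ∈ Icc 0 (r * s⁻¹ * Γ.L), s * x / r ∈ Icc 0 Γ.L := fun x hx => ⟨by
      have := hx.1; positivity, by
      rw [div_le_iff₀ hr]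
      have := mul_le_mul_of_nonneg_left hx.2 hs.le
      have e : s * (r * s⁻¹ * Γ.L) = Γ.L * r := by field_simp
      linarith⟩
    intro x hx y hy hxy
    have := Γ.strictAntiOn_f (hm x hx) (hm y hy) (by gcongr)
    exact mul_lt_mul_of_pos_left this (by positivity)
  convexOn_f := by
    have hm : ∀ x ∈ Icc 0 (r * s⁻¹ * Γ.L), s * x / r ∈ Icc 0 Γ.L := fun x hx => ⟨by
      have := hx.1; positivity, by
      rw [div_le_iff₀ hr]
      have := mul_le_mul_of_nonneg_left hx.2 hs.le
      have e : s * (r * s⁻¹ * Γ.L) = Γ.L * r := by field_simp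
      linarith⟩
    refine ⟨convex_Icc _ _, fun x hx y hy p q hp hq hpq => ?_⟩
    have := Γ.convexOn_f.2 (hm x hx) (hm y hy) hp hq hpq
    have e : s * (p • x + q • y) / r = p • (s * x / r) + q • (s * y / r) := by
      simp only [smul_eq_mul]; ring
    rw [← e] at this
    have := mul_le_mul_of_nonneg_left this (by positivity : 0 ≤ r * s)
    simp only [smul_eq_mul] at this ⊢
    linarith

variable (Γ : ConvexCurve) {r s : ℝ} (hr : 0 < r) (hs : 0 < s)

lemma scale_f_eq (x : ℝ) : (Γ.scale r s hr hs).f x = r * s * Γ.f (x / (r * s⁻¹)) := by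
  have : s * x / r = x / (r * s⁻¹) := by field_simp
  rw [← this]
  rfl

lemma scale_g_eq {y : ℝ} (hy : y ∈ Icc 0 (r * s * Γ.M)) :
    (Γ.scale r s hr hs).g y = r * s⁻¹ * Γ.g (y / (r * s)) := by
  have hrs : 0 < r * s := by positivity
  have hy' : y / (r * s) ∈ Icc 0 Γ.M :=
    ⟨by have := hy.1; positivity, by rw [div_le_iff₀ hrs]; linarith [hy.2]⟩
  have hg := Γ.g_mem hy'
  have hx : r * s⁻¹ * Γ.g (y / (r * s)) ∈ Icc 0 (Γ.scale r s hr hs).L :=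
    ⟨by have := hg.1; positivity, mul_le_mul_of_nonneg_left hg.2 (by positivity)⟩
  rw [← (Γ.scale r s hr hs).g_f hx, scale_f_eq]
  congr 1
  rw [mul_div_cancel_left₀ _ (by positivity), Γ.f_g hy']
  field_simp

lemma scale_area : (Γ.scale r s hr hs).area = r ^ 2 * Γ.area := by
  rw [area_eq_integral, area_eq_integral]
  simp only [scale_f_eq]
  have h := intervalIntegral.integral_comp_div (a := 0) (b := r * s⁻¹ * Γ.L) Γ.f
    (by positivity : r * s⁻¹ ≠ 0)
  rw [intervalIntegral.integral_const_mul]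
  change r * s * ∫ x in 0..r * s⁻¹ * Γ.L, Γ.f (x / (r * s⁻¹)) = _
  rw [h, zero_div, mul_div_cancel_left₀ _ (by positivity), smul_eq_mul]
  field_simp

lemma scale_graph {α β : ℝ} (hαβ : (α, β) ∈ Γ.graph) :
    (r * s⁻¹ * α, r * s * β) ∈ (Γ.scale r s hr hs).graph := by
  obtain ⟨h1, h2⟩ := hαβ
  simp only at h1 h2
  refine ⟨⟨?_, ?_⟩, ?_⟩
  · have := h1.1
    change 0 ≤ r * s⁻¹ * α
    positivity
  · exact mul_le_mul_of_nonneg_left h1.2 (by positivity)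
  · simp only [scale_f_eq]
    rw [mul_div_cancel_left₀ _ (by positivity), h2]

end ConvexCurve

/-! ### Assembly of the two estimates. -/

lemma mul_div_sqrt_eq_rpow {r s : ℝ} (hr : 0 < r) (hs : 0 < s) :
    r * s⁻¹ / √(r * s) = r ^ (1 / 2 : ℝ) * s ^ (-3 / 2 : ℝ) := by
  have e : r * s⁻¹ = r ^ (1 : ℝ) * s ^ (-1 : ℝ) := by rw [Real.rpow_one, Real.rpow_neg_one]
  rw [Real.sqrt_eq_rpow, Real.mul_rpow hr.le hs.le, e, mul_div_mul_comm, ← Real.rpow_sub hr,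
    ← Real.rpow_sub hs]
  norm_num

lemma mul_div_sqrt_eq_rpow' {r s : ℝ} (hr : 0 < r) (hs : 0 < s) :
    r * s / √(r * s⁻¹) = r ^ (1 / 2 : ℝ) * s ^ (3 / 2 : ℝ) := by
  have h := mul_div_sqrt_eq_rpow hr (inv_pos.mpr hs)
  rw [inv_inv] at h
  rw [h, ← Real.rpow_neg_one, ← Real.rpow_mul hs.le]
  norm_num

theorem mainTheorem3 (Γ : ConvexCurve) (α β : ℝ)
    (hα : 0 < α) (hβ : 0 < β) (hαβ : (α, β) ∈ Γ.graph)
    (m n : ℕ) (a b : ℕ → ℝ)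
    (hf : IsPiecewiseMonotoneC2 Γ.f α Γ.L m a)
    (hg : IsPiecewiseMonotoneC2 Γ.g β Γ.M n b) :
    -- the two integrals below are finite
    (IntervalIntegrable (fun x => deriv2Ico Γ.f α Γ.L x ^ (1 / 3 : ℝ)) volume α Γ.L ∧
      IntervalIntegrable (fun y => deriv2Ico Γ.g β Γ.M y ^ (1 / 3 : ℝ)) volume β Γ.M) ∧
    -- part (a)
    ((∀ j k : ℤ, ((j : ℝ), (k : ℝ)) ∉ Γ.graph) →
      α < ⌊Γ.L⌋ → β < ⌊Γ.M⌋ →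
      ∀ δ ε : ℝ, 0 < δ → δ < ⌊Γ.L⌋ - α → 0 < ε → ε < ⌊Γ.M⌋ - β →
        |(latticeCount Γ.f Γ.L : ℝ) - Γ.area + (Γ.L + Γ.M) / 2| ≤
          6 * ((∫ x in α..Γ.L, deriv2Ico Γ.f α Γ.L x ^ (1 / 3 : ℝ)) +
              ∫ y in β..Γ.M, deriv2Ico Γ.g β Γ.M y ^ (1 / 3 : ℝ))
          + 175 * (1 / deriv2Ico Γ.f α Γ.L (Γ.L - δ) ^ (1 / 2 : ℝ) +
              1 / deriv2Ico Γ.g β Γ.M (Γ.M - ε) ^ (1 / 2 : ℝ))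
          + 525 * ((∑ i ∈ Finset.range m, 1 / deriv2Ico Γ.f α Γ.L (a i) ^ (1 / 2 : ℝ)) +
              ∑ i ∈ Finset.range n, 1 / deriv2Ico Γ.g β Γ.M (b i) ^ (1 / 2 : ℝ))
          + 1 / 4 * ((∑ i ∈ Finset.range m, |derivIco Γ.f α Γ.L (a i)|) +
              ∑ i ∈ Finset.range n, |derivIco Γ.g β Γ.M (b i)|)
          + 1 / 2 * (δ + ε) + 3 * ((m : ℝ) + n) + 5 + Γ.L / Γ.M + Γ.M / Γ.L) ∧
    -- part (b)
    (α < Γ.L / 2 → β < Γ.M / 2 →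
      ∀ δ ε : ℝ → ℝ,
        (∀ r, 0 < r → 0 < δ r ∧ δ r < Γ.L / 2 - α) →
        (∀ r, 0 < r → 0 < ε r ∧ ε r < Γ.M / 2 - β) →
        ∀ r s : ℝ, 0 < r → 0 < s → 1 ≤ r * s⁻¹ * Γ.L → 1 ≤ r * s * Γ.M →
          |(Γ.count r s : ℝ) - r ^ 2 * Γ.area + r * (s⁻¹ * Γ.L + s * Γ.M) / 2| ≤
            6 * r ^ (2 / 3 : ℝ) *
              ((∫ x in α..Γ.L, deriv2Ico Γ.f α Γ.L x ^ (1 / 3 : ℝ)) +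
                ∫ y in β..Γ.M, deriv2Ico Γ.g β Γ.M y ^ (1 / 3 : ℝ))
            + 175 * r ^ (1 / 2 : ℝ) *
              (s ^ (-3 / 2 : ℝ) / deriv2Ico Γ.f α Γ.L (Γ.L - δ r) ^ (1 / 2 : ℝ) +
                s ^ (3 / 2 : ℝ) / deriv2Ico Γ.g β Γ.M (Γ.M - ε r) ^ (1 / 2 : ℝ))
            + 525 * r ^ (1 / 2 : ℝ) *
              ((∑ i ∈ Finset.range m,
                  s ^ (-3 / 2 : ℝ) / deriv2Ico Γ.f α Γ.L (a i) ^ (1 / 2 : ℝ)) +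
                ∑ i ∈ Finset.range n,
                  s ^ (3 / 2 : ℝ) / deriv2Ico Γ.g β Γ.M (b i) ^ (1 / 2 : ℝ))
            + 1 / 4 *
              ((∑ i ∈ Finset.range m, s ^ 2 * |derivIco Γ.f α Γ.L (a i)|) +
                ∑ i ∈ Finset.range n, s ^ (-2 : ℤ) * |derivIco Γ.g β Γ.M (b i)|)
            + 1 / 2 * r * (s⁻¹ * δ r + s * ε r) + 3 * ((m : ℝ) + n) + 5
            + s ^ (-2 : ℤ) * (Γ.L / Γ.M) + s ^ 2 * (Γ.M / Γ.L)) := by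
  obtain ⟨hαm, hfα, hαL⟩ := ConvexCurve.mem_of_graph hαβ hβ
  obtain ⟨hβm, hgβ, hβM⟩ := ConvexCurve.mem_Icc_of_graph hαβ hα
  have A := hf.arcData hα.le hαL Γ.f_L (Γ.continuousOn_f.mono (Icc_subset_Icc_left hα.le))
  have B := hg.arcData hβ.le hβM Γ.g_M (Γ.continuousOn_g.mono (Icc_subset_Icc_left hβ.le))
  have hLM : 0 < Γ.L / Γ.M := div_pos Γ.L_pos Γ.M_pos
  have hML : 0 < Γ.M / Γ.L := div_pos Γ.M_pos Γ.L_pos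
  refine ⟨⟨A.intervalIntegrable_rpow, B.intervalIntegrable_rpow⟩, ?_, ?_⟩
  · intro _ _ _ δ ε hδ hδ' hε hε'
    have h := ConvexCurve.abs_latticeCount_sub_le hαβ hα hβ A B hδ
      (by linarith [Int.floor_le Γ.L]) hε (by linarith [Int.floor_le Γ.M])
    unfold ArcData.bound at h
    simp only [← Real.sqrt_eq_rpow]
    -- The constant 1 is absorbed by `5 + L / M + M / L`.
    linarith
  · intro hα2 hβ2 δ ε hδ hε r s hr hs _ _
    obtain ⟨hδ, hδ'⟩ := hδ r hr
    obtain ⟨hε, hε'⟩ := hε r hr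
    have hd : 0 < r * s⁻¹ := by positivity
    have hc : 0 < r * s := by positivity
    have hL := Γ.L_pos
    have hM := Γ.M_pos
    -- For `f` the vertical factor is `r s` and the horizontal one `r s⁻¹`; for `g` they trade
    -- places. The tails stretch to `r s⁻¹ δ(r)` and `r s ε(r)`.
    have As : ArcData (Γ.scale r s hr hs).f _ _ (r * s⁻¹ * α) (Γ.scale r s hr hs).L m _ :=
      (A.scale hc hd).congr fun x _ => Γ.scale_f_eq hr hs x
    have Bs : ArcData (Γ.scale r s hr hs).g _ _ (r * s * β) (Γ.scale r s hr hs).M n _ :=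
      (B.scale hd hc).congr fun y hy => Γ.scale_g_eq hr hs
        ⟨(by positivity : 0 ≤ r * s * β).trans hy.1, hy.2⟩
    have hδL : r * s⁻¹ * δ r < (Γ.scale r s hr hs).L - r * s⁻¹ * α := by
      have := mul_lt_mul_of_pos_left (by linarith : δ r < Γ.L - α) hd
      rw [mul_sub] at this
      exact this
    have hεM : r * s * ε r < (Γ.scale r s hr hs).M - r * s * β := by
      have := mul_lt_mul_of_pos_left (by linarith : ε r < Γ.M - β) hc
      rw [mul_sub] at this
      exact this
    have h := ConvexCurve.abs_latticeCount_sub_le (Γ.scale_graph hr hs hαβ) (by positivity)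
      (by positivity) As Bs (by positivity) hδL (by positivity) hεM
    have b1 := A.bound_scale hc hd (δ r)
    have b2 := B.bound_scale hd hc (ε r)
    change |(Γ.count r s : ℝ) - _ + (r * s⁻¹ * Γ.L + r * s * Γ.M) / 2| ≤
      ArcData.bound _ _ _ (r * s⁻¹ * Γ.L) _ _ _ + ArcData.bound _ _ _ (r * s * Γ.M) _ _ _ + 1 at h
    rw [b1, b2, Γ.scale_area] at h
    have e1 : (r * s * (r * s⁻¹)) ^ (1 / 3 : ℝ) = r ^ (2 / 3 : ℝ) := by
      have : r * s * (r * s⁻¹) = r ^ (2 : ℝ) := by rw [Real.rpow_two]; field_simp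
      rw [this, ← Real.rpow_mul hr.le]
      norm_num
    have e2 : (r * s⁻¹ * (r * s)) ^ (1 / 3 : ℝ) = r ^ (2 / 3 : ℝ) := by
      rw [mul_comm, e1]
    have e3 : r * s / (r * s⁻¹) = s ^ 2 := by field_simp
    have e4 : r * s⁻¹ / (r * s) = s ^ (-2 : ℤ) := by
      rw [zpow_neg, zpow_ofNat]; field_simp
    rw [e1, e2, e3, e4, mul_div_sqrt_eq_rpow hr hs, mul_div_sqrt_eq_rpow' hr hs] at h
    have hs1 : 0 < s ^ (-2 : ℤ) * (Γ.L / Γ.M) := by positivity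
    have hs2 : 0 < s ^ 2 * (Γ.M / Γ.L) := by positivity
    have e5 : r * s⁻¹ * Γ.L + r * s * Γ.M = r * (s⁻¹ * Γ.L + s * Γ.M) := by ring
    rw [e5] at h
    have q1 : ∀ (c : ℝ) (k : ℕ) (F : ℕ → ℝ), ∑ i ∈ Finset.range k, c / F i ^ (1 / 2 : ℝ) =
        c * ∑ i ∈ Finset.range k, 1 / √(F i) := fun c k F => by
      rw [Finset.mul_sum]
      exact Finset.sum_congr rfl fun i _ => by rw [Real.sqrt_eq_rpow, mul_one_div]
    have q2 : ∀ c y : ℝ, c / y ^ (1 / 2 : ℝ) = c * (1 / √y) := fun c y => by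
      rw [Real.sqrt_eq_rpow, mul_one_div]
    rw [q1 _ _ (fun i => deriv2Ico Γ.f α Γ.L (a i)), q1 _ _ (fun i => deriv2Ico Γ.g β Γ.M (b i)),
      q2, q2, ← Finset.mul_sum, ← Finset.mul_sum]
    refine h.trans ?_
    linarith
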